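/- Let $\mathbb S^2\subset\mathbb R^3$ be the unit sphere with surface measure $d\sigma=\sin\vartheta\,d\vartheta\,d\varphi$, let $Y_{\ell,m}$ ($\ell\in\mathbb N_0$, $-\ell\le m\le\ell$) be the $L^2(\mathbb S^2)$-orthonormal spherical harmonics, so that $\Delta_{\mathbb S^2}Y_{\ell,m}=-\ell(\ell+1)Y_{\ell,m}$ for the spherical Laplacian $\Delta_{\mathbb S^2}$, and for $s\in\mathbb R$ let $H^s(\mathbb S^2)=(\mathrm{Id}-\Delta_{\mathbb S^2})^{-s/2}L^2(\mathbb S^2)$ be the Sobolev space (of generalized functions if $s<0$) of real-valued elements with norm $\|f\|_{H^s}=\|(\mathrm{Id}-\Delta_{\mathbb S^2})^{s/2}f\|_{L^2(\mathbb S^2)}$. For a probability space $(\Omega,\mathcal A,\mathbb P)$ and $p\in[1,\infty)$, let $L^p(\Omega;H^s(\mathbb S^2))$ be the space of $H^s$-valued random variables $Z$ with finite norm $\|Z\|_{L^p(\Omega;H^s)}=\mathbb E[\|Z\|_{H^s}^p]^{1/p}$. Let $T\ge 0$, and let $W$ be an isotropic $Q$-Wiener process on $[0,T]$ with values in $L^2(\mathbb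 S^2)$ and angular power spectrum $(A_\ell)_{\ell\ge0}$, $A_\ell\ge0$, i.e. $W$ has continuous paths and $$W(t)=\sum_{\ell=0}^\infty\Big(\sqrt{A_\ell}\,\beta^{\ell,0}(t)\,Y_{\ell,0}+\sqrt{2A_\ell}\sum_{m=1}^{\ell}\big(\beta^{\ell,m}(t)\,\mathrm{Re}\,Y_{\ell,m}+\beta^{\ell,-m}(t)\,\mathrm{Im}\,Y_{\ell,m}\big)\Big)$$ with independent standard real Brownian motions $\beta^{\ell,m}$, $-\ell\le m\le\ell$. Let $(u_1,u_2)$ be the solution on $[0,T]$ of the stochastic wave equation $\partial_{tt}u-\Delta_{\mathbb S^2}u=\dot W$ with $u=u_1$, $\partial_tu=u_2$ and deterministic initial value $(v_1,v_2)$, that is, $$u_1(t)=v_1+\int_0^tu_2(r)\,dr,\qquad u_2(t)=v_2+\int_0^t\Delta_{\mathbb S^2}u_1(r)\,dr+W(t),$$ understood in the sense of generalized functions (tested with spherical harmonics, the tested processes having continuous paths). Assume that there are $\ell_0\in\mathbb N$, $\alpha>2$ and $C>0$ with $A_\ell\le C\,\ell^{-\alpha}$ for all $\ell>\ell_0$.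 Let $m\in\mathbb N$, $m\ge1$. 1. For every $s<\alpha/2$ there is a constant $M$, depending only on $s$, $m$, $T$ and $(A_\ell)_\ell$, such that whenever $v_1\in H^s(\mathbb S^2)$ and $v_2\in H^{s-1}(\mathbb S^2)$, then for all $t\in[0,T]$ one has $u_1(t)\in L^{2m}(\Omega;H^s(\mathbb S^2))$ and $$\|u_1(t)\|_{L^{2m}(\Omega;H^s(\mathbb S^2))}\le M\big(1+\|v_1\|_{H^s(\mathbb S^2)}+\|v_2\|_{H^{s-1}(\mathbb S^2)}\big)<+\infty.$$ 2. For every $s<\alpha/2-1$ there is a constant $M$, depending only on $s$, $m$, $T$ and $(A_\ell)_\ell$, such that whenever $v_1\in H^{s+1}(\mathbb S^2)$ and $v_2\in H^{s}(\mathbb S^2)$, then for all $t\in[0,T]$ one has $u_2(t)\in L^{2m}(\Omega;H^s(\mathbb S^2))$ and $$\|u_2(t)\|_{L^{2m}(\Omega;H^s(\mathbb S^2))}\le M\big(1+\|v_1\|_{H^{s+1}(\mathbb S^2)}+\|v_2\|_{H^{s}(\mathbb S^2)}\big)<+\infty.$$ -/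

import Mathlib

open MeasureTheory ProbabilityTheory Filter Topology
open scoped ENNReal NNReal

noncomputable section

namespace SphereWave

/-! ### The unit sphere, spherical coordinates and the surface measure -/

/-- The unit sphere of three-dimensional Euclidean space. -/
abbrev S2 : Type := Metric.sphere (0 : EuclideanSpace ℝ (Fin 3)) 1

/-- The point with polar angle `ϑ` and azimuth `φ`. -/
def sphPoint (ϑ φ : ℝ) : S2 :=
  ⟨!₂[Real.sin ϑ * Real.cos φ, Real.sin ϑ * Real.sin φ, Real.cos ϑ], by
    rw [mem_sphere_zero_iff_norm, EuclideanSpace.norm_eq, Real.sqrt_eq_one]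
    simp only [Fin.sum_univ_three, Real.norm_eq_abs, sq_abs]
    simp
    nlinarith [Real.sin_sq_add_cos_sq ϑ, Real.sin_sq_add_cos_sq φ]⟩

lemma continuous_sphPoint : Continuous (fun p : ℝ × ℝ => sphPoint p.1 p.2) := by
  refine Continuous.subtype_mk ?_ _
  refine (PiLp.continuous_toLp 2 _).comp (continuous_pi fun i => ?_)
  fin_cases i <;> simp <;> fun_prop

/-- The polar angle of a point of the sphere. -/
def polarAngle (x : S2) : ℝ := Real.arccos (x.1 2)

/-- The azimuth of a point of the sphere, determined up to multiples of `2π` away from the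
poles (where its value is irrelevant in everything that follows). -/
def azimuth (x : S2) : ℝ := Complex.arg ⟨x.1 0, x.1 1⟩

/-- The surface measure `dσ = sin ϑ dϑ dφ` on the sphere, with `0 ≤ ϑ ≤ π`, `0 ≤ φ < 2π`. -/
def sphereMeasure : Measure S2 :=
  Measure.map (fun p : ℝ × ℝ => sphPoint p.1 p.2)
    (((volume.restrict (Set.Icc 0 Real.pi)).withDensity
        (fun ϑ => ENNReal.ofReal (Real.sin ϑ))).prod
      (volume.restrict (Set.Ico 0 (2 * Real.pi))))

/-- The Hilbert space `L²(S²)` of real-valued functions. -/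
abbrev L2S2 : Type := Lp ℝ 2 sphereMeasure

/-! ### Spherical harmonics -/

/-- The Legendre polynomial of degree `ℓ`, by Rodrigues' formula. -/
def legendreP (ℓ : ℕ) : Polynomial ℝ :=
  Polynomial.C (((2 : ℝ) ^ ℓ * (ℓ.factorial : ℝ))⁻¹) *
    (Polynomial.derivative)^[ℓ] ((Polynomial.X ^ 2 - 1) ^ ℓ)

/-- The associated Legendre function
`P_{ℓ,m}(μ) = (-1)^m (1 - μ²)^{m/2} P_ℓ^{(m)}(μ)`, for `0 ≤ m ≤ ℓ` and `μ ∈ [-1,1]`. -/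
def assocLegendre (ℓ m : ℕ) (μ : ℝ) : ℝ :=
  (-1) ^ m * (√(1 - μ ^ 2)) ^ m * ((Polynomial.derivative)^[m] (legendreP ℓ)).eval μ

/-- `L_{ℓ,m}(ϑ) = √((2ℓ+1)/(4π) · (ℓ-m)!/(ℓ+m)!) P_{ℓ,m}(cos ϑ)`, for `0 ≤ m ≤ ℓ`, so that
the complex spherical harmonics are `Y_{ℓ,m} = L_{ℓ,m}(ϑ) exp(i m φ)`. -/
def normLegendre (ℓ m : ℕ) (ϑ : ℝ) : ℝ :=
  √((2 * (ℓ : ℝ) + 1) / (4 * Real.pi) * (((ℓ - m).factorial : ℝ) / ((ℓ + m).factorial : ℝ))) *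
    assocLegendre ℓ m (Real.cos ϑ)

/-- The real spherical harmonics, for `-ℓ ≤ m ≤ ℓ`: these are `Y_{ℓ,0}` for `m = 0`,
`√2 Re Y_{ℓ,m}` for `m > 0` and `√2 Im Y_{ℓ,|m|}` for `m < 0`. -/
def harm (ℓ : ℕ) (m : ℤ) (x : S2) : ℝ :=
  if m = 0 then normLegendre ℓ 0 (polarAngle x)
  else if 0 < m then
    √2 * (normLegendre ℓ m.natAbs (polarAngle x) * Real.cos (m.natAbs * azimuth x))
  else √2 * (normLegendre ℓ m.natAbs (polarAngle x) * Real.sin (m.natAbs * azimuth x))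

/-- The index set of the spherical harmonics: pairs `(ℓ, m)` with `-ℓ ≤ m ≤ ℓ`. -/
abbrev HarmIndex : Type := {k : ℕ × ℤ // |k.2| ≤ (k.1 : ℤ)}

/-- The finite linear combinations of spherical harmonics (the test functions). -/
def SphPoly : Submodule ℝ (S2 → ℝ) :=
  Submodule.span ℝ (Set.range fun k : HarmIndex => harm k.1.1 k.1.2)

/-- The spherical harmonic with index `k`, as a test function. -/
def harmTest (k : HarmIndex) : SphPoly :=
  ⟨harm k.1.1 k.1.2, Submodule.subset_span ⟨k, rfl⟩⟩

/-- `g` is the spherical Laplacian (Laplace--Beltrami operator) of `f`, in spherical coordinates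
away from the poles:
`Δ f = (sin ϑ)⁻¹ ∂_ϑ (sin ϑ ∂_ϑ f) + (sin ϑ)⁻² ∂_φ² f`. It is used for smooth `f` and `g` only,
for which this determines `g` everywhere. -/
def IsSphericalLaplacian (f g : S2 → ℝ) : Prop :=
  ∀ ϑ ∈ Set.Ioo 0 Real.pi, ∀ φ : ℝ,
    g (sphPoint ϑ φ) =
      (Real.sin ϑ)⁻¹ *
          deriv (fun a => Real.sin a * deriv (fun b => f (sphPoint b φ)) a) ϑ +
        ((Real.sin ϑ) ^ 2)⁻¹ * deriv (fun a => deriv (fun b => f (sphPoint ϑ b)) a) φ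

/-! ### Generalized functions and Sobolev spaces -/

/-- Generalized functions on the sphere: real linear functionals on the finite linear combinations
of spherical harmonics. Every distribution on the sphere, in particular every element of a Sobolev
space of negative order, is determined by the functional that it defines here. -/
abbrev GenFun : Type := SphPoly →ₗ[ℝ] ℝ

/-- `(Id - Δ)^{s/2} f = g` for a generalized function `f` and `g ∈ L²(S²)`: the fractional power
multiplies the coefficient with index `(ℓ, m)` by `(1 + ℓ(ℓ+1))^{s/2}`. -/
def IsBesselPotential (s : ℝ) (f : GenFun) (g : L2S2) : Prop :=
  ∀ k : HarmIndex, ∫ x, g x * harm k.1.1 k.1.2 x ∂sphereMeasure =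
    (1 + (k.1.1 : ℝ) * ((k.1.1 : ℝ) + 1)) ^ (s / 2) * f (harmTest k)

/-- Membership in `H^s(S²) = (Id - Δ)^{-s/2} L²(S²)`. -/
def MemSobolev (s : ℝ) (f : GenFun) : Prop := ∃ g : L2S2, IsBesselPotential s f g

/-- The norm `‖f‖_{H^s(S²)} = ‖(Id - Δ)^{s/2} f‖_{L²(S²)}`, equal to `∞` if `f ∉ H^s(S²)`.
(The element `g` over which the infimum is taken is unique, if it exists.) -/
def sobolevNorm (s : ℝ) (f : GenFun) : ℝ≥0∞ :=
  ⨅ (g : L2S2) (_ : IsBesselPotential s f g), ‖g‖ₑ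

/-- Membership in `L^p(Ω; H^s(S²))`: the random generalized function `Z` is almost surely in
`H^s(S²)`, and `(Id - Δ)^{s/2} Z`, as a random variable with values in `L²(S²)`, is strongly
measurable and has a finite moment of order `p`. -/
def MemLpSobolev {Ω : Type*} [MeasurableSpace Ω] (P : Measure Ω) (p : ℝ≥0∞) (s : ℝ)
    (Z : Ω → GenFun) : Prop :=
  ∃ G : Ω → L2S2, MemLp G p P ∧ ∀ᵐ ω ∂P, IsBesselPotential s (Z ω) (G ω)

/-- The norm `E[‖Z‖_{H^s(S²)}^p]^{1/p}` of `L^p(Ω; H^s(S²))`. -/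
def lpSobolevNorm {Ω : Type*} [MeasurableSpace Ω] (P : Measure Ω) (p : ℝ≥0∞) (s : ℝ)
    (Z : Ω → GenFun) : ℝ≥0∞ :=
  eLpNorm (fun ω => sobolevNorm s (Z ω)) p P

/-! ### The driving noise -/

/-- A real-valued standard Brownian motion on `[0,T]`: a centered Gaussian process with covariance
`min s t` and almost surely continuous paths. -/
structure IsBrownianOn {Ω : Type*} [MeasurableSpace Ω] (P : Measure Ω) (T : ℝ)
    (B : ℝ → Ω → ℝ) : Prop where
  gaussian : IsGaussianProcess (fun t : Set.Icc (0 : ℝ) T => B t) P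
  mean_zero : ∀ t ∈ Set.Icc 0 T, ∫ ω, B t ω ∂P = 0
  cov_eq : ∀ s ∈ Set.Icc 0 T, ∀ t ∈ Set.Icc 0 T, cov[B s, B t; P] = min s t
  continuous_paths : ∀ᵐ ω ∂P, ContinuousOn (fun t => B t ω) (Set.Icc 0 T)

/-- `W` is an isotropic `Q`-Wiener process on `[0,T]` with values in `L²(S²)` and angular power
spectrum `A`: its paths are continuous, and
`W(t) = ∑_ℓ (√A_ℓ β^{ℓ,0}(t) Y_{ℓ,0}
  + √(2 A_ℓ) ∑_{m=1}^ℓ (β^{ℓ,m}(t) Re Y_{ℓ,m} + β^{ℓ,-m}(t) Im Y_{ℓ,m}))`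
in `L²(S²)` for independent standard Brownian motions `β^{ℓ,m}`, `-ℓ ≤ m ≤ ℓ`. -/
structure IsIsotropicWiener {Ω : Type*} [MeasurableSpace Ω] (P : Measure Ω) (T : ℝ) (A : ℕ → ℝ)
    (W : ℝ → Ω → L2S2) : Prop where
  continuous_paths : ∀ᵐ ω ∂P, ContinuousOn (fun t => W t ω) (Set.Icc 0 T)
  expansion : ∃ β : ℕ → ℤ → ℝ → Ω → ℝ,
    (∀ k : HarmIndex, IsBrownianOn P T (β k.1.1 k.1.2)) ∧
    iIndepFun (fun (k : HarmIndex) ω (t : Set.Icc (0 : ℝ) T) => β k.1.1 k.1.2 t ω) P ∧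
    ∀ t ∈ Set.Icc 0 T, ∀ᵐ ω ∂P,
      Tendsto (fun κ : ℕ => eLpNorm (fun x => W t ω x -
          ∑ ℓ ∈ Finset.range (κ + 1), ∑ m ∈ Finset.Icc (-(ℓ : ℤ)) ℓ,
            √(A ℓ) * β ℓ m t ω * harm ℓ m x) 2 sphereMeasure) atTop (𝓝 0)

/-! ### The stochastic wave equation -/

/-- `(u₁, u₂)` solves, on `[0,T]`, the stochastic wave equation
`du₁ = u₂ dt`, `du₂ = Δu₁ dt + dW` with initial value `(v₁, v₂)`, in integral form
`u₁(t) = v₁ + ∫₀ᵗ u₂(r) dr`, `u₂(t) = v₂ + ∫₀ᵗ Δu₁(r) dr + W(t)`, understood in the sense of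
generalized functions: the equations are tested with `p`, and `Δu₁` acts on `p` by
`⟨Δu₁, p⟩ = ⟨u₁, Δp⟩`. -/
structure IsWaveSolution {Ω : Type*} [MeasurableSpace Ω] (P : Measure Ω) (T : ℝ)
    (W : ℝ → Ω → L2S2) (v₁ v₂ : GenFun) (u₁ u₂ : ℝ → Ω → GenFun) : Prop where
  continuous_fst : ∀ p : SphPoly, ∀ᵐ ω ∂P, ContinuousOn (fun t => u₁ t ω p) (Set.Icc 0 T)
  continuous_snd : ∀ p : SphPoly, ∀ᵐ ω ∂P, ContinuousOn (fun t => u₂ t ω p) (Set.Icc 0 T)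
  position : ∀ p : SphPoly, ∀ t ∈ Set.Icc 0 T, ∀ᵐ ω ∂P,
    u₁ t ω p = v₁ p + ∫ r in (0 : ℝ)..t, u₂ r ω p
  velocity : ∀ p q : SphPoly, IsSphericalLaplacian p.1 q.1 → ∀ t ∈ Set.Icc 0 T, ∀ᵐ ω ∂P,
    u₂ t ω p = v₂ p + (∫ r in (0 : ℝ)..t, u₁ r ω q) + ∫ x, W t ω x * p.1 x ∂sphereMeasure

end SphereWave

end

open SphereWave

/-! The spherical harmonics diagonalize the equation. Tested with a harmonic of degree ℓ, it becomes
a scalar oscillator of frequency ω = √(ℓ(ℓ+1)) driven by √A_ℓ times a Brownian motion. Variation of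
constants (`oscillator_of_continuousOn`) gives its solution: cosines and sines times the initial
coefficients, plus a Wiener integral with kernel sin(ω(t-r))/ω for the position and cos(ω(t-r)) for
the velocity.

The kernels are smooth, so the Wiener integral can be defined pathwise by partial integration. It is
an almost sure limit of centered Gaussian Riemann sums, so a variance bound and Fatou's lemma
control all its moments (`IsBrownianOn.eLpNorm_wienerIntegral_le`). The position kernel is of order
1/ω for ℓ ≥ 1 and thus gains one derivative over the velocity kernel.

By orthogonality, the squared Sobolev norm is a sum of squared coefficients, and the triangle
inequality in L^m turns bounds on the coefficients into a bound in L^{2m} (`exists_memLp_inner_eq`,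
`memLpSobolev_of_coeff`). The noise contributes a multiple of ∑ (2ℓ+1) (1+ℓ(ℓ+1))^{σ-1} A_ℓ,
dominated for large ℓ by ∑ ℓ^{2σ-1-α}, which converges for σ < α/2. The position is measured in
order σ and the velocity in order σ - 1.

This rests on the explicit harmonics being orthonormal (`orthonormal_harmLp`) and eigenfunctions of
the Laplacian (`isSphericalLaplacian_harm`); both follow from Legendre's equation. Completeness of
the harmonics is not needed: Bessel's inequality controls the initial data, and the Bessel potential
of the solution is built as an orthogonal series. -/

noncomputable section

namespace SphereWave

/-! ### Legendre polynomials -/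

section Legendre

open Polynomial

/-- The derivatives of `(X² - 1)^ℓ` satisfy the Gegenbauer-type differential equations. -/
lemma iterate_derivative_sq_sub_one_pow_ode (ℓ n : ℕ) :
    ((X : ℝ[X]) ^ 2 - 1) * derivative^[n + 2] ((X ^ 2 - 1) ^ ℓ) +
      C (2 * ((n : ℝ) + 1 - ℓ)) * X * derivative^[n + 1] ((X ^ 2 - 1) ^ ℓ) +
      C (((n : ℝ) + 1) * (n - 2 * ℓ)) * derivative^[n] ((X ^ 2 - 1) ^ ℓ) = 0 := by
  induction n with
  | zero =>
    rcases ℓ with _ | ℓ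
    · simp
    -- The function (X² - 1)^(ℓ+1) satisfies this first-order equation. One differentiation gives
    -- the case n = 0; the induction step differentiates once more.
    have h : ((X : ℝ[X]) ^ 2 - 1) * derivative ((X ^ 2 - 1) ^ (ℓ + 1)) =
        C (2 * ((ℓ : ℝ) + 1)) * X * (X ^ 2 - 1) ^ (ℓ + 1) := by
      simp [derivative_pow]
      ring
    have h' := congrArg derivative h
    simp only [derivative_mul, derivative_C, derivative_X, zero_mul, derivative_sub,
      derivative_X_pow, derivative_one] at h'
    simp only [zero_add, Function.iterate_succ, Function.iterate_zero, Function.comp, id]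
    simp at h' ⊢
    linear_combination h'
  | succ n ih =>
    have h' := congrArg derivative ih
    simp only [derivative_mul, derivative_C, derivative_X, zero_mul, derivative_sub,
      derivative_X_pow, derivative_one, derivative_add, derivative_zero,
      ← Function.iterate_succ_apply' (f := derivative)] at h'
    simp only [show (n + 2).succ = n + 3 from rfl, show (n + 1).succ = n + 2 from rfl,
      show n.succ = n + 1 from rfl, show n + 1 + 2 = n + 3 from rfl,
      show n + 1 + 1 = n + 2 from rfl,
      map_add, map_sub, map_mul, map_one, map_natCast, map_ofNat, Nat.cast_add, Nat.cast_one,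
      Nat.cast_ofNat] at h' ⊢
    linear_combination h'

lemma iterate_derivative_legendreP (ℓ m : ℕ) :
    derivative^[m] (legendreP ℓ) = C (((2 : ℝ) ^ ℓ * (ℓ.factorial : ℝ))⁻¹) *
      derivative^[ℓ + m] ((X ^ 2 - 1) ^ ℓ) := by
  rw [legendreP, iterate_derivative_C_mul, ← Function.iterate_add_apply, add_comm]

/-- Legendre's differential equation, differentiated `m` times. -/
lemma legendreP_ode (ℓ m : ℕ) (x : ℝ) :
    (1 - x ^ 2) * (derivative^[m + 2] (legendreP ℓ)).eval x -
      2 * (m + 1) * x * (derivative^[m + 1] (legendreP ℓ)).eval x =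
      -((ℓ - m) * (ℓ + m + 1)) * (derivative^[m] (legendreP ℓ)).eval x := by
  have h := congrArg (eval x) (iterate_derivative_sq_sub_one_pow_ode ℓ (ℓ + m))
  simp only [iterate_derivative_legendreP, eval_mul, eval_C, eval_add, eval_sub, eval_pow, eval_X,
    eval_one, eval_zero, Nat.cast_add, ← add_assoc] at h ⊢
  linear_combination (-((2 : ℝ) ^ ℓ * (ℓ.factorial : ℝ))⁻¹) * h

/-- The weighted inner product of the `m`-th derivatives of two Legendre polynomials. -/
def legendreInner (m k ℓ : ℕ) : ℝ :=
  ∫ x in (-1 : ℝ)..1, (1 - x ^ 2) ^ m *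
    ((derivative^[m] (legendreP k)).eval x * (derivative^[m] (legendreP ℓ)).eval x)

lemma legendreInner_comm (m k ℓ : ℕ) : legendreInner m k ℓ = legendreInner m ℓ k := by
  unfold legendreInner
  congr 1
  ext x
  ring

lemma hasDerivAt_iterate_derivative (p : ℝ[X]) (m : ℕ) (x : ℝ) :
    HasDerivAt (fun x => (derivative^[m] p).eval x) ((derivative^[m + 1] p).eval x) x := by
  rw [Function.iterate_succ_apply']
  exact Polynomial.hasDerivAt _ x

/-- Integration by parts: the weight (1 - x²)^(m+1) kills the boundary terms, and `legendreP_ode` in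
Sturm–Liouville form evaluates the derivative of the weighted factor. -/
lemma legendreInner_succ (m k ℓ : ℕ) :
    legendreInner (m + 1) k ℓ = (ℓ - m) * (ℓ + m + 1) * legendreInner m k ℓ := by
  have key : ∀ x : ℝ, HasDerivAt (fun x : ℝ => (1 - x ^ 2) ^ (m + 1) *
      ((derivative^[m + 1] (legendreP ℓ)).eval x * (derivative^[m] (legendreP k)).eval x))
      ((1 - x ^ 2) ^ (m + 1) * ((derivative^[m + 1] (legendreP k)).eval x *
        (derivative^[m + 1] (legendreP ℓ)).eval x) -
      (ℓ - m) * (ℓ + m + 1) * ((1 - x ^ 2) ^ m * ((derivative^[m] (legendreP k)).eval x *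
        (derivative^[m] (legendreP ℓ)).eval x))) x := by
    intro x
    have h1 : HasDerivAt (fun x : ℝ => (1 - x ^ 2) ^ (m + 1))
        ((m + 1 : ℝ) * (1 - x ^ 2) ^ m * (-(2 * x))) x := by
      have := (((hasDerivAt_id x).fun_pow 2).const_sub 1).fun_pow (m + 1)
      simpa using this
    refine (h1.fun_mul ((hasDerivAt_iterate_derivative (legendreP ℓ) (m + 1) x).fun_mul
      (hasDerivAt_iterate_derivative (legendreP k) m x))).congr_deriv ?_
    have := legendreP_ode ℓ m x
    linear_combination ((1 - x ^ 2) ^ m * (derivative^[m] (legendreP k)).eval x) * this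
  have h := intervalIntegral.integral_eq_sub_of_hasDerivAt (a := -1) (b := 1)
    (fun x _ => key x) (Continuous.intervalIntegrable (by fun_prop) _ _)
  rw [intervalIntegral.integral_sub (Continuous.intervalIntegrable (by fun_prop) _ _)
    (Continuous.intervalIntegrable (by fun_prop) _ _), intervalIntegral.integral_const_mul] at h
  simp only [one_pow, sub_self, zero_pow (Nat.succ_ne_zero m), even_two, Even.neg_pow,
    zero_mul] at h
  unfold legendreInner
  linarith

/-- Symmetry of a Sturm–Liouville operator: exchanging k and ℓ in the recursion gives two
expressions for one integral, with eigenvalues differing by (k - ℓ)(k + ℓ + 1). -/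
lemma legendreInner_eq_zero {k ℓ : ℕ} (h : k ≠ ℓ) (m : ℕ) : legendreInner m k ℓ = 0 := by
  have h1 := legendreInner_succ m k ℓ
  have h2 := legendreInner_succ m ℓ k
  rw [legendreInner_comm (m + 1), legendreInner_comm m] at h2
  have h3 : ((k : ℝ) - ℓ) * (k + ℓ + 1) * legendreInner m k ℓ = 0 := by
    linear_combination h1 - h2
  have h4 : ((k : ℝ) - ℓ) ≠ 0 := sub_ne_zero.2 (by exact_mod_cast h)
  have h5 : ((k : ℝ) + ℓ + 1) ≠ 0 := by positivity
  simpa [h4, h5] using h3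

lemma legendreInner_self_eq (ℓ m : ℕ) (hm : m ≤ ℓ) :
    legendreInner m ℓ ℓ =
      ((ℓ + m).factorial : ℝ) / ((ℓ - m).factorial : ℝ) * legendreInner 0 ℓ ℓ := by
  induction m with
  | zero => simp [div_self (Nat.cast_ne_zero.2 (Nat.factorial_ne_zero ℓ) : (ℓ.factorial : ℝ) ≠ 0)]
  | succ m ih =>
    rw [legendreInner_succ, ih (by omega)]
    obtain ⟨d, rfl⟩ := Nat.exists_eq_add_of_lt hm
    have e1 : m + d + 1 - m = d + 1 := by omega
    have e2 : m + d + 1 - (m + 1) = d := by omega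
    rw [e1, e2, ← add_assoc (m + d + 1), Nat.factorial_succ (m + d + 1 + m), Nat.factorial_succ d]
    have : (d.factorial : ℝ) ≠ 0 := Nat.cast_ne_zero.2 (Nat.factorial_ne_zero _)
    push_cast
    field_simp
    ring

/-- The derivative of x (1 - x²)^(n+1) integrates to zero over [-1,1]. -/
lemma integral_one_sub_sq_pow_succ (n : ℕ) :
    (2 * (n : ℝ) + 3) * ∫ x in (-1 : ℝ)..1, (1 - x ^ 2) ^ (n + 1) =
      2 * (n + 1) * ∫ x in (-1 : ℝ)..1, (1 - x ^ 2) ^ n := by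
  have key : ∀ x : ℝ, HasDerivAt (fun x : ℝ => x * (1 - x ^ 2) ^ (n + 1))
      ((2 * (n : ℝ) + 3) * (1 - x ^ 2) ^ (n + 1) - 2 * (n + 1) * (1 - x ^ 2) ^ n) x := by
    intro x
    have h1 : HasDerivAt (fun x : ℝ => (1 - x ^ 2) ^ (n + 1))
        ((n + 1 : ℝ) * (1 - x ^ 2) ^ n * (-(2 * x))) x := by
      have := (((hasDerivAt_id x).fun_pow 2).const_sub 1).fun_pow (n + 1)
      simpa using this
    refine ((hasDerivAt_id' x).fun_mul h1).congr_deriv ?_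
    ring
  have h := intervalIntegral.integral_eq_sub_of_hasDerivAt (a := -1) (b := 1)
    (fun x _ => key x) (Continuous.intervalIntegrable (by fun_prop) _ _)
  rw [intervalIntegral.integral_sub (Continuous.intervalIntegrable (by fun_prop) _ _)
    (Continuous.intervalIntegrable (by fun_prop) _ _), intervalIntegral.integral_const_mul,
    intervalIntegral.integral_const_mul] at h
  simp only [one_pow, sub_self, zero_pow (Nat.succ_ne_zero n), even_two, Even.neg_pow,
    mul_zero] at h
  linarith

lemma integral_one_sub_sq_pow (n : ℕ) :
    ∫ x in (-1 : ℝ)..1, (1 - x ^ 2) ^ n =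
      2 / (2 * n + 1) * ((2 ^ n * (n.factorial : ℝ)) ^ 2 / ((2 * n).factorial : ℝ)) := by
  induction n with
  | zero => norm_num
  | succ n ih =>
    have h := integral_one_sub_sq_pow_succ n
    rw [ih] at h
    have h3 : (2 * (n : ℝ) + 3) ≠ 0 := by positivity
    rw [← mul_right_inj' h3, h]
    rw [show 2 * (n + 1) = 2 * n + 1 + 1 by ring, Nat.factorial_succ (2 * n + 1),
      Nat.factorial_succ (2 * n), Nat.factorial_succ n]
    have : ((2 * n).factorial : ℝ) ≠ 0 := Nat.cast_ne_zero.2 (Nat.factorial_ne_zero _)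
    push_cast
    field_simp
    ring

lemma iterate_derivative_two_mul_sq_sub_one_pow (ℓ : ℕ) :
    derivative^[ℓ + ℓ] (((X : ℝ[X]) ^ 2 - 1) ^ ℓ) = C ((2 * ℓ).factorial : ℝ) := by
  have hd : (((X : ℝ[X]) ^ 2 - 1) ^ ℓ).natDegree = 2 * ℓ := by
    rw [natDegree_pow, show (X : ℝ[X]) ^ 2 - 1 = X ^ 2 - C 1 by simp, natDegree_X_pow_sub_C]
    ring
  have hm : (((X : ℝ[X]) ^ 2 - 1) ^ ℓ).Monic := by
    apply Monic.pow
    rw [show (X : ℝ[X]) ^ 2 - 1 = X ^ 2 - C 1 by simp]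
    exact monic_X_pow_sub_C 1 two_ne_zero
  have h0 : (derivative^[ℓ + ℓ] (((X : ℝ[X]) ^ 2 - 1) ^ ℓ)).natDegree = 0 := by
    have := natDegree_iterate_derivative (((X : ℝ[X]) ^ 2 - 1) ^ ℓ) (ℓ + ℓ)
    omega
  rw [eq_C_of_natDegree_eq_zero h0, coeff_iterate_derivative, zero_add, ← two_mul,
    Nat.descFactorial_self]
  have : (((X : ℝ[X]) ^ 2 - 1) ^ ℓ).coeff (2 * ℓ) = 1 := by
    rw [← hd]; exact hm
  rw [this]
  simp

/-- The squared norm of the Legendre polynomial of degree `ℓ`. -/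
lemma legendreInner_zero_self (ℓ : ℕ) : legendreInner 0 ℓ ℓ = 2 / (2 * ℓ + 1) := by
  -- At m = ℓ the differentiated Legendre polynomial is constant, so the inner product is an
  -- explicit multiple of ∫ (1 - x²)^ℓ; the recursion then carries its value back to m = 0.
  have h := legendreInner_self_eq ℓ ℓ le_rfl
  have h2 : legendreInner ℓ ℓ ℓ = (((2 : ℝ) ^ ℓ * (ℓ.factorial : ℝ))⁻¹ * (2 * ℓ).factorial) ^ 2 *
      ∫ x in (-1 : ℝ)..1, (1 - x ^ 2) ^ ℓ := by
    unfold legendreInner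
    rw [← intervalIntegral.integral_const_mul]
    congr 1
    ext x
    rw [iterate_derivative_legendreP, iterate_derivative_two_mul_sq_sub_one_pow]
    simp only [eval_mul, eval_C]
    ring
  rw [h2, integral_one_sub_sq_pow, Nat.sub_self, Nat.factorial_zero, ← two_mul] at h
  have h3 : ((2 * ℓ).factorial : ℝ) ≠ 0 := Nat.cast_ne_zero.2 (Nat.factorial_ne_zero _)
  have h4 : (ℓ.factorial : ℝ) ≠ 0 := Nat.cast_ne_zero.2 (Nat.factorial_ne_zero _)
  rw [← mul_right_inj' h3]
  simp only [Nat.cast_one, div_one] at h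
  rw [← h]
  field_simp

lemma legendreInner_self (ℓ m : ℕ) (hm : m ≤ ℓ) :
    legendreInner m ℓ ℓ =
      2 / (2 * ℓ + 1) * (((ℓ + m).factorial : ℝ) / ((ℓ - m).factorial : ℝ)) := by
  rw [legendreInner_self_eq ℓ m hm, legendreInner_zero_self, mul_comm]

end Legendre

/-! ### Spherical harmonics in spherical coordinates -/

/-- The dependence of the real spherical harmonics on the azimuth. -/
def azimuthal (m : ℤ) (φ : ℝ) : ℝ :=
  if m = 0 then 1 else if 0 < m then √2 * Real.cos (m.natAbs * φ)
  else √2 * Real.sin (m.natAbs * φ)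

lemma harm_eq (ℓ : ℕ) (m : ℤ) (x : S2) :
    harm ℓ m x = normLegendre ℓ m.natAbs (polarAngle x) * azimuthal m (azimuth x) := by
  unfold harm azimuthal
  split_ifs with h1 h2
  · simp [h1]
  · ring
  · ring

lemma polarAngle_sphPoint {ϑ : ℝ} (hϑ : ϑ ∈ Set.Icc 0 Real.pi) (φ : ℝ) :
    polarAngle (sphPoint ϑ φ) = ϑ := by
  simp [polarAngle, sphPoint, Real.arccos_cos hϑ.1 hϑ.2]

/-- The argument is normalized to (-π, π], which costs a multiple of 2π. The poles are excluded
because the azimuth there is the argument of 0, whatever φ is. -/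
lemma exists_azimuth_sphPoint {ϑ : ℝ} (hϑ : ϑ ∈ Set.Ioo 0 Real.pi) (φ : ℝ) :
    ∃ k : ℤ, azimuth (sphPoint ϑ φ) = φ + k * (2 * Real.pi) := by
  have h := Complex.arg_mul_cos_add_sin_mul_I_sub (Real.sin_pos_of_mem_Ioo hϑ) φ
  refine ⟨⌊(Real.pi - φ) / (2 * Real.pi)⌋, ?_⟩
  have h2 : azimuth (sphPoint ϑ φ) = Complex.arg
      ((Real.sin ϑ : ℝ) * (Complex.cos (φ : ℂ) + Complex.sin (φ : ℂ) * Complex.I)) := by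
    unfold azimuth
    congr 1
    rw [← Complex.ofReal_cos, ← Complex.ofReal_sin]
    apply Complex.ext <;> simp [sphPoint, -Complex.ofReal_cos, -Complex.ofReal_sin]
  rw [h2]
  linarith

lemma azimuthal_add_int_mul_two_pi (m : ℤ) (φ : ℝ) (k : ℤ) :
    azimuthal m (φ + k * (2 * Real.pi)) = azimuthal m φ := by
  have h : (m.natAbs : ℝ) * (φ + k * (2 * Real.pi)) =
      m.natAbs * φ + ((m.natAbs * k : ℤ) : ℝ) * (2 * Real.pi) := by
    rw [Int.cast_mul, Int.cast_natCast]
    ring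
  simp only [azimuthal, h, Real.cos_add_int_mul_two_pi, Real.sin_add_int_mul_two_pi]

lemma harm_sphPoint (ℓ : ℕ) (m : ℤ) {ϑ : ℝ} (hϑ : ϑ ∈ Set.Ioo 0 Real.pi) (φ : ℝ) :
    harm ℓ m (sphPoint ϑ φ) = normLegendre ℓ m.natAbs ϑ * azimuthal m φ := by
  obtain ⟨k, hk⟩ := exists_azimuth_sphPoint hϑ φ
  rw [harm_eq, polarAngle_sphPoint (Set.Ioo_subset_Icc_self hϑ), hk,
    azimuthal_add_int_mul_two_pi]

lemma continuous_azimuthal (m : ℤ) : Continuous (azimuthal m) := by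
  unfold azimuthal
  split_ifs <;> fun_prop

lemma continuous_normLegendre (ℓ m : ℕ) : Continuous (normLegendre ℓ m) := by
  unfold normLegendre assocLegendre
  fun_prop

lemma continuous_polarAngle : Continuous polarAngle := by
  unfold polarAngle
  refine Real.continuous_arccos.comp ?_
  fun_prop

lemma measurable_azimuth : Measurable azimuth := by
  have h (i : Fin 3) : Continuous fun x : S2 => x.1 i := by fun_prop
  have h2 : azimuth = fun x : S2 => Complex.arg ((x.1 0 : ℝ) + (x.1 1 : ℝ) * Complex.I) := by
    ext x
    unfold azimuth
    congr 1
    apply Complex.ext <;> simp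
  rw [h2]
  refine Complex.measurable_arg.comp (Continuous.measurable ?_)
  exact (Complex.continuous_ofReal.comp (h 0)).add
    ((Complex.continuous_ofReal.comp (h 1)).mul continuous_const)

lemma measurable_harm (ℓ : ℕ) (m : ℤ) : Measurable (harm ℓ m) := by
  rw [funext (harm_eq ℓ m)]
  exact ((continuous_normLegendre _ _).comp continuous_polarAngle).measurable.mul
    ((continuous_azimuthal m).measurable.comp measurable_azimuth)

lemma abs_azimuthal_le (m : ℤ) (φ : ℝ) : |azimuthal m φ| ≤ √2 := by
  have h2 : (1 : ℝ) ≤ √2 := Real.one_le_sqrt.2 one_le_two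
  unfold azimuthal
  split_ifs
  · simp
  · rw [abs_mul, abs_of_nonneg (Real.sqrt_nonneg 2)]
    exact mul_le_of_le_one_right (Real.sqrt_nonneg 2) (Real.abs_cos_le_one _)
  · rw [abs_mul, abs_of_nonneg (Real.sqrt_nonneg 2)]
    exact mul_le_of_le_one_right (Real.sqrt_nonneg 2) (Real.abs_sin_le_one _)

lemma exists_bound_harm (ℓ : ℕ) (m : ℤ) : ∃ K, ∀ x, ‖harm ℓ m x‖ ≤ K := by
  obtain ⟨K, hK⟩ := isCompact_univ.exists_bound_of_continuousOn
    ((continuous_normLegendre ℓ m.natAbs).comp continuous_polarAngle).continuousOn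
  refine ⟨K * √2, fun x => ?_⟩
  rw [harm_eq, norm_mul]
  exact mul_le_mul (hK x (Set.mem_univ x)) (abs_azimuthal_le _ _) (norm_nonneg _)
    ((norm_nonneg _).trans (hK x (Set.mem_univ x)))

instance : IsFiniteMeasure ((volume.restrict (Set.Icc 0 Real.pi)).withDensity
    (fun ϑ => ENNReal.ofReal (Real.sin ϑ))) :=
  isFiniteMeasure_withDensity_ofReal
    (Real.continuous_sin.integrableOn_Icc (μ := volume)).hasFiniteIntegral

instance : IsFiniteMeasure sphereMeasure := by
  unfold sphereMeasure
  infer_instance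

lemma memLp_harm (ℓ : ℕ) (m : ℤ) (p : ℝ≥0∞) : MemLp (harm ℓ m) p sphereMeasure := by
  obtain ⟨K, hK⟩ := exists_bound_harm ℓ m
  exact MemLp.of_bound (measurable_harm ℓ m).aestronglyMeasurable K (ae_of_all _ hK)

/-- Integration over the sphere of a product of a function of the polar angle and a function of
the azimuth. -/
lemma integral_sphereMeasure_of_eq_mul {F : S2 → ℝ} {f g : ℝ → ℝ}
    (hF : AEStronglyMeasurable F sphereMeasure)
    (h : ∀ ϑ ∈ Set.Ioo 0 Real.pi, ∀ φ, F (sphPoint ϑ φ) = f ϑ * g φ) :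
    ∫ x, F x ∂sphereMeasure =
      (∫ ϑ in (0 : ℝ)..Real.pi, Real.sin ϑ * f ϑ) * ∫ φ in (0 : ℝ)..2 * Real.pi, g φ := by
  unfold sphereMeasure at hF ⊢
  rw [integral_map continuous_sphPoint.measurable.aemeasurable hF]
  set μ := (volume.restrict (Set.Icc 0 Real.pi)).withDensity
    (fun ϑ => ENNReal.ofReal (Real.sin ϑ)) with hμ
  -- The factorization is only known away from the poles, which are negligible.
  have hae : ∀ᵐ ϑ ∂μ, ϑ ∈ Set.Ioo 0 Real.pi := by
    have h0 : ∀ᵐ ϑ ∂(volume.restrict (Set.Icc 0 Real.pi)), ϑ ∈ Set.Ioo 0 Real.pi := by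
      rw [← restrict_Ioo_eq_restrict_Icc]
      exact ae_restrict_mem measurableSet_Ioo
    exact (withDensity_absolutelyContinuous _ _).ae_le h0
  rw [integral_congr_ae (g := fun p : ℝ × ℝ => f p.1 * g p.2), integral_prod_mul]
  · congr 1
    · rw [integral_withDensity_eq_integral_toReal_smul (by fun_prop) (by simp),
        intervalIntegral.integral_of_le Real.pi_pos.le, ← integral_Icc_eq_integral_Ioc]
      refine setIntegral_congr_fun measurableSet_Icc fun ϑ hϑ => ?_
      simp [ENNReal.toReal_ofReal (Real.sin_nonneg_of_mem_Icc hϑ)]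
    · rw [intervalIntegral.integral_of_le (by positivity), ← integral_Icc_eq_integral_Ioc,
        integral_Icc_eq_integral_Ico]
  · have := (Measure.quasiMeasurePreserving_fst (μ := μ)
      (ν := volume.restrict (Set.Ico 0 (2 * Real.pi)))).ae hae
    filter_upwards [this] with p hp
    exact h p.1 hp p.2

/-! ### Orthonormality -/

lemma integral_cos_int_mul (n : ℤ) :
    ∫ φ in (0 : ℝ)..2 * Real.pi, Real.cos (n * φ) = if n = 0 then 2 * Real.pi else 0 := by
  split_ifs with h
  · simp [h]
  · have hn : (n : ℝ) ≠ 0 := by exact_mod_cast h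
    rw [intervalIntegral.integral_comp_mul_left (fun x => Real.cos x) hn, integral_cos]
    have := Real.sin_add_int_mul_two_pi 0 n
    simp only [zero_add, Real.sin_zero] at this
    simp [this]

lemma integral_sin_int_mul (n : ℤ) :
    ∫ φ in (0 : ℝ)..2 * Real.pi, Real.sin (n * φ) = 0 := by
  by_cases h : n = 0
  · simp [h]
  · have hn : (n : ℝ) ≠ 0 := by exact_mod_cast h
    rw [intervalIntegral.integral_comp_mul_left (fun x => Real.sin x) hn, integral_sin]
    have := Real.cos_add_int_mul_two_pi 0 n
    simp only [zero_add, Real.cos_zero] at this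
    simp [this]

lemma integral_cos_mul_cos (a b : ℕ) :
    ∫ φ in (0 : ℝ)..2 * Real.pi, Real.cos (a * φ) * Real.cos (b * φ) =
      ((if (a : ℤ) - b = 0 then 2 * Real.pi else 0) +
        (if (a : ℤ) + b = 0 then 2 * Real.pi else 0)) / 2 := by
  rw [← integral_cos_int_mul, ← integral_cos_int_mul, ← intervalIntegral.integral_add
    (Continuous.intervalIntegrable (by fun_prop) _ _)
    (Continuous.intervalIntegrable (by fun_prop) _ _), ← intervalIntegral.integral_div]
  congr 1
  ext φ
  push_cast
  rw [sub_mul, add_mul, Real.cos_add, Real.cos_sub]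
  ring

lemma integral_sin_mul_sin (a b : ℕ) :
    ∫ φ in (0 : ℝ)..2 * Real.pi, Real.sin (a * φ) * Real.sin (b * φ) =
      ((if (a : ℤ) - b = 0 then 2 * Real.pi else 0) -
        (if (a : ℤ) + b = 0 then 2 * Real.pi else 0)) / 2 := by
  rw [← integral_cos_int_mul, ← integral_cos_int_mul, ← intervalIntegral.integral_sub
    (Continuous.intervalIntegrable (by fun_prop) _ _)
    (Continuous.intervalIntegrable (by fun_prop) _ _), ← intervalIntegral.integral_div]
  congr 1
  ext φ
  push_cast
  rw [sub_mul, add_mul, Real.cos_add, Real.cos_sub]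
  ring

lemma integral_sin_mul_cos (a b : ℕ) :
    ∫ φ in (0 : ℝ)..2 * Real.pi, Real.sin (a * φ) * Real.cos (b * φ) = 0 := by
  have h : (∫ φ in (0 : ℝ)..2 * Real.pi,
      (Real.sin (((a : ℤ) - b : ℤ) * φ) + Real.sin (((a : ℤ) + b : ℤ) * φ)) / 2) = 0 := by
    rw [intervalIntegral.integral_div, intervalIntegral.integral_add
      (Continuous.intervalIntegrable (by fun_prop) _ _)
      (Continuous.intervalIntegrable (by fun_prop) _ _), integral_sin_int_mul,
      integral_sin_int_mul]
    simp
  rw [← h]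
  congr 1
  ext φ
  push_cast
  rw [sub_mul, add_mul, Real.sin_add, Real.sin_sub]
  ring

lemma azimuthal_of_pos {m : ℤ} (h : 0 < m) (φ : ℝ) :
    azimuthal m φ = √2 * Real.cos (m.natAbs * φ) := by
  simp [azimuthal, h, h.ne']

lemma azimuthal_of_neg {m : ℤ} (h : m < 0) (φ : ℝ) :
    azimuthal m φ = √2 * Real.sin (m.natAbs * φ) := by
  simp [azimuthal, h.le, h.ne]

lemma integral_azimuthal_mul (m n : ℤ) :
    ∫ φ in (0 : ℝ)..2 * Real.pi, azimuthal m φ * azimuthal n φ =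
      if m = n then 2 * Real.pi else 0 := by
  have h2 : √2 * √2 = (2 : ℝ) := Real.mul_self_sqrt zero_le_two
  rcases lt_trichotomy m 0 with hm | rfl | hm <;> rcases lt_trichotomy n 0 with hn | rfl | hn
  · simp only [azimuthal_of_neg hm, azimuthal_of_neg hn, mul_mul_mul_comm √2 _ √2, h2,
      intervalIntegral.integral_const_mul, integral_sin_mul_sin]
    rw [if_neg (show ¬ ((m.natAbs : ℤ) + n.natAbs = 0) by omega)]
    split_ifs <;> first | omega | ring
  · simp only [azimuthal_of_neg hm, show ∀ φ, azimuthal 0 φ = 1 by simp [azimuthal], mul_one,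
      intervalIntegral.integral_const_mul]
    have := integral_sin_int_mul (m.natAbs : ℤ)
    rw [Int.cast_natCast] at this
    rw [this, if_neg hm.ne, mul_zero]
  · simp only [azimuthal_of_neg hm, azimuthal_of_pos hn, mul_mul_mul_comm √2 _ √2, h2,
      intervalIntegral.integral_const_mul, integral_sin_mul_cos]
    rw [if_neg (by omega), mul_zero]
  · simp only [azimuthal_of_neg hn, show ∀ φ, azimuthal 0 φ = 1 by simp [azimuthal], one_mul,
      intervalIntegral.integral_const_mul]
    have := integral_sin_int_mul (n.natAbs : ℤ)
    rw [Int.cast_natCast] at this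
    rw [this, if_neg hn.ne', mul_zero]
  · simp [azimuthal]
  · simp only [azimuthal_of_pos hn, show ∀ φ, azimuthal 0 φ = 1 by simp [azimuthal], one_mul,
      intervalIntegral.integral_const_mul]
    have := integral_cos_int_mul (n.natAbs : ℤ)
    rw [Int.cast_natCast] at this
    rw [this, if_neg hn.ne, if_neg (by omega), mul_zero]
  · simp only [azimuthal_of_neg hn, azimuthal_of_pos hm, mul_mul_mul_comm √2 _ √2, h2,
      intervalIntegral.integral_const_mul, mul_comm (Real.cos _), integral_sin_mul_cos]
    rw [if_neg (by omega), mul_zero]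
  · simp only [azimuthal_of_pos hm, show ∀ φ, azimuthal 0 φ = 1 by simp [azimuthal], mul_one,
      intervalIntegral.integral_const_mul]
    have := integral_cos_int_mul (m.natAbs : ℤ)
    rw [Int.cast_natCast] at this
    rw [this, if_neg hm.ne', if_neg (by omega), mul_zero]
  · simp only [azimuthal_of_pos hm, azimuthal_of_pos hn, mul_mul_mul_comm √2 _ √2, h2,
      intervalIntegral.integral_const_mul, integral_cos_mul_cos]
    rw [if_neg (show ¬ ((m.natAbs : ℤ) + n.natAbs = 0) by omega)]
    split_ifs <;> first | omega | ring

/-- Substitution x = cos ϑ: the two square roots multiply to (1 - x²)^m and the two signs (-1)^m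
cancel. -/
lemma integral_sin_mul_assocLegendre_mul (k ℓ m : ℕ) :
    ∫ ϑ in (0 : ℝ)..Real.pi, Real.sin ϑ *
      (assocLegendre k m (Real.cos ϑ) * assocLegendre ℓ m (Real.cos ϑ)) =
        legendreInner m k ℓ := by
  have h := intervalIntegral.integral_comp_mul_deriv (a := 0) (b := Real.pi)
    (f := Real.cos) (f' := fun x => -Real.sin x)
    (g := fun x => (1 - x ^ 2) ^ m * ((Polynomial.derivative^[m] (legendreP k)).eval x *
      (Polynomial.derivative^[m] (legendreP ℓ)).eval x))
    (fun x _ => Real.hasDerivAt_cos x) (by fun_prop) (by fun_prop)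
  rw [Real.cos_zero, Real.cos_pi, intervalIntegral.integral_symm (-1) 1] at h
  unfold legendreInner
  rw [← neg_inj, ← h, ← intervalIntegral.integral_neg]
  congr 1
  ext ϑ
  have h1 : (√(1 - Real.cos ϑ ^ 2)) ^ m * (√(1 - Real.cos ϑ ^ 2)) ^ m =
      (1 - Real.cos ϑ ^ 2) ^ m := by
    rw [← mul_pow, Real.mul_self_sqrt]
    nlinarith [Real.sin_sq_add_cos_sq ϑ, sq_nonneg (Real.sin ϑ)]
  have h2 : ((-1 : ℝ) ^ m) * (-1) ^ m = 1 := by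
    rw [← mul_pow]; simp
  simp only [assocLegendre, Function.comp]
  rw [← h1]
  linear_combination (-Real.sin ϑ * (√(1 - Real.cos ϑ ^ 2)) ^ m * (√(1 - Real.cos ϑ ^ 2)) ^ m *
    ((Polynomial.derivative^[m] (legendreP k)).eval (Real.cos ϑ) *
      (Polynomial.derivative^[m] (legendreP ℓ)).eval (Real.cos ϑ))) * h2

lemma integral_sin_mul_normLegendre_mul {k ℓ m : ℕ} (hℓ : m ≤ ℓ) :
    ∫ ϑ in (0 : ℝ)..Real.pi, Real.sin ϑ * (normLegendre k m ϑ * normLegendre ℓ m ϑ) =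
      if k = ℓ then (2 * Real.pi)⁻¹ else 0 := by
  unfold normLegendre
  set a : ℕ → ℝ := fun ℓ =>
    (2 * (ℓ : ℝ) + 1) / (4 * Real.pi) * (((ℓ - m).factorial : ℝ) / ((ℓ + m).factorial : ℝ))
  have h : ∀ ϑ, Real.sin ϑ * (√(a k) * assocLegendre k m (Real.cos ϑ) *
      (√(a ℓ) * assocLegendre ℓ m (Real.cos ϑ))) = √(a k) * √(a ℓ) * (Real.sin ϑ *
      (assocLegendre k m (Real.cos ϑ) * assocLegendre ℓ m (Real.cos ϑ))) := fun ϑ => by ring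
  change ∫ ϑ in (0 : ℝ)..Real.pi, Real.sin ϑ * (√(a k) * assocLegendre k m (Real.cos ϑ) *
      (√(a ℓ) * assocLegendre ℓ m (Real.cos ϑ))) = _
  simp only [h]
  rw [intervalIntegral.integral_const_mul, integral_sin_mul_assocLegendre_mul]
  split_ifs with hk
  · subst hk
    rw [Real.mul_self_sqrt (by positivity), legendreInner_self _ _ hℓ]
    have h3 : ((k - m).factorial : ℝ) ≠ 0 := Nat.cast_ne_zero.2 (Nat.factorial_ne_zero _)
    have h4 : ((k + m).factorial : ℝ) ≠ 0 := Nat.cast_ne_zero.2 (Nat.factorial_ne_zero _)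
    simp only [a]
    have := Real.pi_pos
    field_simp
    norm_num
  · rw [legendreInner_eq_zero hk, mul_zero]

lemma integral_harm_mul_harm (k k' : HarmIndex) :
    ∫ x, harm k.1.1 k.1.2 x * harm k'.1.1 k'.1.2 x ∂sphereMeasure =
      if k = k' then 1 else 0 := by
  obtain ⟨⟨ℓ, m⟩, hk⟩ := k
  obtain ⟨⟨ℓ', m'⟩, hk'⟩ := k'
  simp only at hk hk' ⊢
  rw [integral_sphereMeasure_of_eq_mul
    (f := fun ϑ => normLegendre ℓ m.natAbs ϑ * normLegendre ℓ' m'.natAbs ϑ)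
    (g := fun φ => azimuthal m φ * azimuthal m' φ)
    ((measurable_harm _ _).fun_mul (measurable_harm _ _)).aestronglyMeasurable
    (fun ϑ hϑ φ => by rw [harm_sphPoint _ _ hϑ, harm_sphPoint _ _ hϑ]; ring),
    integral_azimuthal_mul]
  by_cases hm : m = m'
  · subst hm
    have hle : m.natAbs ≤ ℓ' := by
      rw [Int.abs_eq_natAbs] at hk'
      exact_mod_cast hk'
    rw [integral_sin_mul_normLegendre_mul hle]
    have := Real.pi_pos
    by_cases hℓ : ℓ = ℓ'
    · subst hℓ
      simp
      field_simp
    · simp [hℓ]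
  · simp [hm]

/-- The spherical harmonic with index `k`, as an element of `L²(S²)`. -/
def harmLp (k : HarmIndex) : L2S2 := (memLp_harm k.1.1 k.1.2 2).toLp _

lemma inner_harmLp (g : L2S2) (k : HarmIndex) :
    inner ℝ (harmLp k) g = ∫ x, g x * harm k.1.1 k.1.2 x ∂sphereMeasure := by
  rw [L2.inner_def]
  refine integral_congr_ae ?_
  filter_upwards [(memLp_harm k.1.1 k.1.2 2).coeFn_toLp] with x hx
  simp [harmLp, hx, mul_comm]

lemma orthonormal_harmLp : Orthonormal ℝ harmLp := by
  rw [orthonormal_iff_ite]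
  intro k k'
  rw [inner_harmLp, ← integral_harm_mul_harm k k']
  refine integral_congr_ae ?_
  filter_upwards [(memLp_harm k'.1.1 k'.1.2 2).coeFn_toLp] with x hx
  simp [harmLp, hx, mul_comm]

/-! ### The spherical harmonics are eigenfunctions of the spherical Laplacian -/

lemma deriv_deriv_azimuthal (m : ℤ) (φ : ℝ) :
    deriv (fun a => deriv (azimuthal m) a) φ = -(m.natAbs : ℝ) ^ 2 * azimuthal m φ := by
  have hc (c a : ℝ) : HasDerivAt (fun x => Real.cos (c * x)) (-(c * Real.sin (c * a))) a := by
    have := (Real.hasDerivAt_cos (c * a)).comp a ((hasDerivAt_id a).const_mul c)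
    exact this.congr_deriv (by ring)
  have hs (c a : ℝ) : HasDerivAt (fun x => Real.sin (c * x)) (c * Real.cos (c * a)) a := by
    have := (Real.hasDerivAt_sin (c * a)).comp a ((hasDerivAt_id a).const_mul c)
    exact this.congr_deriv (by ring)
  rcases lt_trichotomy m 0 with hm | rfl | hm
  · have h1 (a : ℝ) : deriv (azimuthal m) a = √2 * (m.natAbs * Real.cos (m.natAbs * a)) := by
      rw [funext (azimuthal_of_neg hm)]
      exact ((hs _ a).const_mul _).deriv
    simp only [h1]
    rw [(((hc _ φ).const_mul _).const_mul _).deriv, azimuthal_of_neg hm]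
    ring
  · have : azimuthal 0 = fun _ => 1 := by ext; simp [azimuthal]
    simp [this]
  · have h1 (a : ℝ) : deriv (azimuthal m) a = √2 * -(m.natAbs * Real.sin (m.natAbs * a)) := by
      rw [funext (azimuthal_of_pos hm)]
      exact ((hc _ a).const_mul _).deriv
    simp only [h1]
    rw [(((hs _ φ).const_mul _).fun_neg.const_mul _).deriv, azimuthal_of_pos hm]
    ring

/-- This is `legendreP_ode` after the substitution x = cos ϑ and conjugation by sin^m. -/
lemma deriv_deriv_sin_pow_mul (ℓ m : ℕ) {ϑ : ℝ} (hϑ : ϑ ∈ Set.Ioo 0 Real.pi) :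
    (Real.sin ϑ)⁻¹ * deriv (fun a => Real.sin a * deriv (fun b => Real.sin b ^ m *
        (Polynomial.derivative^[m] (legendreP ℓ)).eval (Real.cos b)) a) ϑ =
      ((m : ℝ) ^ 2 / Real.sin ϑ ^ 2 - ℓ * (ℓ + 1)) * (Real.sin ϑ ^ m *
        (Polynomial.derivative^[m] (legendreP ℓ)).eval (Real.cos ϑ)) := by
  have hy (j : ℕ) (a : ℝ) : HasDerivAt
      (fun b => (Polynomial.derivative^[j] (legendreP ℓ)).eval (Real.cos b))
      ((Polynomial.derivative^[j + 1] (legendreP ℓ)).eval (Real.cos a) * -Real.sin a) a :=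
    (hasDerivAt_iterate_derivative (legendreP ℓ) j (Real.cos a)).comp a (Real.hasDerivAt_cos a)
  have hp (j : ℕ) (a : ℝ) : HasDerivAt (fun b => Real.sin b ^ j)
      (j * Real.sin a ^ (j - 1) * Real.cos a) a := (Real.hasDerivAt_sin a).fun_pow j
  -- The factor j makes this valid at j = 0, where the exponent j - 1 truncates to 0.
  have e (j : ℕ) (a : ℝ) : (j : ℝ) * Real.sin a ^ (j - 1) * Real.sin a = j * Real.sin a ^ j := by
    rcases j with _ | j
    · simp
    · rw [Nat.add_sub_cancel, pow_succ]; ring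
  have h1 (a : ℝ) : Real.sin a * deriv (fun b => Real.sin b ^ m *
        (Polynomial.derivative^[m] (legendreP ℓ)).eval (Real.cos b)) a =
      m * (Real.sin a ^ m * (Real.cos a *
        (Polynomial.derivative^[m] (legendreP ℓ)).eval (Real.cos a))) -
      Real.sin a ^ (m + 2) * (Polynomial.derivative^[m + 1] (legendreP ℓ)).eval (Real.cos a) := by
    rw [((hp m a).fun_mul (hy m a)).deriv]
    linear_combination (Real.cos a *
      (Polynomial.derivative^[m] (legendreP ℓ)).eval (Real.cos a)) * e m a
  simp only [h1]
  rw [((((hp m ϑ).fun_mul ((Real.hasDerivAt_cos ϑ).fun_mul (hy m ϑ))).const_mul (m : ℝ)).fun_sub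
    ((hp (m + 2) ϑ).fun_mul (hy (m + 1) ϑ))).deriv]
  have hs : Real.sin ϑ ≠ 0 := (Real.sin_pos_of_mem_Ioo hϑ).ne'
  have hode := legendreP_ode ℓ m (Real.cos ϑ)
  have hc : Real.cos ϑ ^ 2 = 1 - Real.sin ϑ ^ 2 := by
    linarith [Real.sin_sq_add_cos_sq ϑ]
  rw [← Real.sin_sq] at hode
  have hm := e m ϑ
  set y := (Polynomial.derivative^[m] (legendreP ℓ)).eval (Real.cos ϑ)
  set y1 := (Polynomial.derivative^[m + 1] (legendreP ℓ)).eval (Real.cos ϑ)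
  set y2 := (Polynomial.derivative^[m + 2] (legendreP ℓ)).eval (Real.cos ϑ)
  have hr : (m : ℝ) * Real.sin ϑ ^ (m - 1) = m * Real.sin ϑ ^ m / Real.sin ϑ := by
    rw [eq_div_iff hs, hm]
  rw [hr, show m + 2 - 1 = m + 1 by omega, pow_succ _ m, pow_add _ m 2]
  push_cast
  field_simp
  linear_combination (m ^ 2 * y * hc + Real.sin ϑ ^ 2 * hode)

lemma normLegendre_of_mem {ℓ m : ℕ} {ϑ : ℝ} (hϑ : ϑ ∈ Set.Ioo 0 Real.pi) :
    normLegendre ℓ m ϑ =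
      √((2 * (ℓ : ℝ) + 1) / (4 * Real.pi) * (((ℓ - m).factorial : ℝ) / ((ℓ + m).factorial : ℝ))) *
      (-1) ^ m * (Real.sin ϑ ^ m *
        (Polynomial.derivative^[m] (legendreP ℓ)).eval (Real.cos ϑ)) := by
  unfold normLegendre assocLegendre
  rw [← Real.sin_sq, Real.sqrt_sq (Real.sin_pos_of_mem_Ioo hϑ).le]
  ring

/-- Separation of variables: the azimuthal part contributes -m²/sin²ϑ, which cancels the same term
in the polar part and leaves -ℓ(ℓ+1). -/
lemma isSphericalLaplacian_harm (ℓ : ℕ) (m : ℤ) :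
    IsSphericalLaplacian (harm ℓ m) (fun x => -((ℓ : ℝ) * (ℓ + 1)) * harm ℓ m x) := by
  intro ϑ hϑ φ
  have h1 : (fun b => harm ℓ m (sphPoint ϑ b)) =
      fun b => normLegendre ℓ m.natAbs ϑ * azimuthal m b := by
    ext b; exact harm_sphPoint ℓ m hϑ b
  set c := √((2 * (ℓ : ℝ) + 1) / (4 * Real.pi) *
    (((ℓ - m.natAbs).factorial : ℝ) / ((ℓ + m.natAbs).factorial : ℝ))) * (-1) ^ m.natAbs with hc
  set q : ℝ → ℝ := fun b => Real.sin b ^ m.natAbs *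
        (Polynomial.derivative^[m.natAbs] (legendreP ℓ)).eval (Real.cos b) with hq
  have h2 : ∀ a ∈ Set.Ioo 0 Real.pi, deriv (fun b => harm ℓ m (sphPoint b φ)) a =
      c * azimuthal m φ * deriv q a := by
    intro a ha
    have : (fun b => harm ℓ m (sphPoint b φ)) =ᶠ[𝓝 a] fun b => c * azimuthal m φ * q b := by
      filter_upwards [isOpen_Ioo.mem_nhds ha] with b hb
      rw [harm_sphPoint ℓ m hb, normLegendre_of_mem hb]
      ring
    rw [this.deriv_eq, deriv_const_mul_field]
  have h3 : (fun a => Real.sin a * deriv (fun b => harm ℓ m (sphPoint b φ)) a) =ᶠ[𝓝 ϑ]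
      fun a => c * azimuthal m φ * (Real.sin a * deriv q a) := by
    filter_upwards [isOpen_Ioo.mem_nhds hϑ] with a ha
    rw [h2 a ha]
    ring
  rw [h3.deriv_eq, deriv_const_mul_field, h1]
  simp only [deriv_const_mul_field]
  rw [deriv_deriv_azimuthal, harm_sphPoint ℓ m hϑ]
  have h4 := deriv_deriv_sin_pow_mul ℓ m.natAbs hϑ
  have h5 : normLegendre ℓ m.natAbs ϑ = c * q ϑ := normLegendre_of_mem hϑ
  rw [h5]
  linear_combination (-(c * azimuthal m φ)) * h4

/-! ### The forced harmonic oscillator -/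

/-- `sin (ω t) / ω`, with its limit `t` for `ω = 0`. -/
def oscSin (ω t : ℝ) : ℝ := if ω = 0 then t else Real.sin (ω * t) / ω

lemma hasDerivAt_cos_mul (ω t : ℝ) :
    HasDerivAt (fun t => Real.cos (ω * t)) (-(ω * Real.sin (ω * t))) t := by
  have := (Real.hasDerivAt_cos (ω * t)).comp t ((hasDerivAt_id t).const_mul ω)
  exact this.congr_deriv (by ring)

lemma hasDerivAt_sin_mul (ω t : ℝ) :
    HasDerivAt (fun t => Real.sin (ω * t)) (ω * Real.cos (ω * t)) t := by
  have := (Real.hasDerivAt_sin (ω * t)).comp t ((hasDerivAt_id t).const_mul ω)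
  exact this.congr_deriv (by ring)

lemma mul_oscSin (ω t : ℝ) : ω * oscSin ω t = Real.sin (ω * t) := by
  unfold oscSin
  split_ifs with h
  · simp [h]
  · field_simp

lemma oscSin_zero (ω : ℝ) : oscSin ω 0 = 0 := by
  simp [oscSin]

lemma hasDerivAt_oscSin (ω t : ℝ) : HasDerivAt (oscSin ω) (Real.cos (ω * t)) t := by
  by_cases h : ω = 0
  · have : oscSin ω = fun t => t := by ext t; simp [oscSin, h]
    rw [this, h]
    simpa using hasDerivAt_id' t
  · have : oscSin ω = fun t => Real.sin (ω * t) / ω := by ext t; simp [oscSin, h]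
    rw [this]
    refine ((hasDerivAt_sin_mul ω t).div_const ω).congr_deriv ?_
    field_simp

lemma hasDerivAt_oscSin_sub (ω t r : ℝ) :
    HasDerivAt (fun r => oscSin ω (t - r)) (-Real.cos (ω * (t - r))) r := by
  have := (hasDerivAt_oscSin ω (t - r)).comp r ((hasDerivAt_id' r).const_sub t)
  exact this.congr_deriv (by ring)

lemma hasDerivAt_cos_mul_sub (ω t r : ℝ) :
    HasDerivAt (fun r => Real.cos (ω * (t - r))) (ω * Real.sin (ω * (t - r))) r := by
  have := (hasDerivAt_cos_mul ω (t - r)).comp r ((hasDerivAt_id' r).const_sub t)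
  exact this.congr_deriv (by ring)

lemma hasDerivAt_sin_mul_sub (ω t r : ℝ) :
    HasDerivAt (fun r => Real.sin (ω * (t - r))) (-(ω * Real.cos (ω * (t - r)))) r := by
  have := (hasDerivAt_sin_mul ω (t - r)).comp r ((hasDerivAt_id' r).const_sub t)
  exact this.congr_deriv (by ring)

/-- Variation of constants for the oscillator `x' = y`, `y = b - ω² ∫ x + w`. -/
lemma oscillator_of_continuous {T ω a b : ℝ} {x y w : ℝ → ℝ} (hx : Continuous x)
    (hy : Continuous y) (hw : Continuous w)
    (h1 : ∀ t ∈ Set.Icc 0 T, x t = a + ∫ r in (0 : ℝ)..t, y r)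
    (h2 : ∀ t ∈ Set.Icc 0 T, y t = b - ω ^ 2 * (∫ r in (0 : ℝ)..t, x r) + w t)
    {t : ℝ} (ht : t ∈ Set.Icc 0 T) :
    x t = Real.cos (ω * t) * a + oscSin ω t * b +
        ∫ r in (0 : ℝ)..t, Real.cos (ω * (t - r)) * w r ∧
      y t = -(ω * Real.sin (ω * t)) * a + Real.cos (ω * t) * b +
        (w t - ∫ r in (0 : ℝ)..t, ω * Real.sin (ω * (t - r)) * w r) := by
  -- X and Z are differentiable on all of ℝ, and on [0,T] they equal x and y - w. Taking w out
  -- matters because w is merely continuous. In the derivatives in r used below, the terms in X and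
  -- Z cancel and only the forcing remains.
  set X : ℝ → ℝ := fun t => a + ∫ r in (0 : ℝ)..t, y r with hX
  set Z : ℝ → ℝ := fun t => b - ω ^ 2 * ∫ r in (0 : ℝ)..t, x r with hZ
  have hX' (r : ℝ) : HasDerivAt X (y r) r :=
    (hy.integral_hasStrictDerivAt 0 r).hasDerivAt.const_add a
  have hZ' (r : ℝ) : HasDerivAt Z (-(ω ^ 2 * x r)) r :=
    ((hx.integral_hasStrictDerivAt 0 r).hasDerivAt.const_mul _).const_sub b
  have hsub : ∀ r ∈ Set.uIcc 0 t, x r = X r ∧ y r = Z r + w r := by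
    intro r hr
    rw [Set.uIcc_of_le ht.1] at hr
    have hr' : r ∈ Set.Icc 0 T := ⟨hr.1, hr.2.trans ht.2⟩
    exact ⟨h1 r hr', h2 r hr'⟩
  constructor
  · have key := intervalIntegral.integral_eq_sub_of_hasDerivAt (a := 0) (b := t)
      (f := fun r => Real.cos (ω * (t - r)) * X r + oscSin ω (t - r) * Z r)
      (f' := fun r => Real.cos (ω * (t - r)) * w r) (fun r hr => by
        refine (((hasDerivAt_cos_mul_sub ω t r).fun_mul (hX' r)).fun_add
          ((hasDerivAt_oscSin_sub ω t r).fun_mul (hZ' r))).congr_deriv ?_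
        rw [(hsub r hr).2, (hsub r hr).1, ← mul_oscSin]
        ring) (Continuous.intervalIntegrable (by fun_prop) _ _)
    rw [key, (hsub t Set.right_mem_uIcc).1]
    simp [oscSin_zero, hX, hZ]
  · have key := intervalIntegral.integral_eq_sub_of_hasDerivAt (a := 0) (b := t)
      (f := fun r => -(ω * Real.sin (ω * (t - r)) * X r) + Real.cos (ω * (t - r)) * Z r)
      (f' := fun r => -(ω * Real.sin (ω * (t - r)) * w r)) (fun r hr => by
        refine ((((hasDerivAt_sin_mul_sub ω t r).const_mul ω).fun_mul (hX' r)).fun_neg.fun_add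
          ((hasDerivAt_cos_mul_sub ω t r).fun_mul (hZ' r))).congr_deriv ?_
        rw [(hsub r hr).2, (hsub r hr).1]
        ring) (Continuous.intervalIntegrable (by fun_prop) _ _)
    rw [intervalIntegral.integral_neg] at key
    rw [(hsub t Set.right_mem_uIcc).2, sub_eq_add_neg, key]
    simp [hX, hZ]
    ring

lemma oscillator_of_continuousOn {T ω a b : ℝ} {x y w : ℝ → ℝ}
    (hx : ContinuousOn x (Set.Icc 0 T)) (hy : ContinuousOn y (Set.Icc 0 T))
    (hw : ContinuousOn w (Set.Icc 0 T))
    (h1 : ∀ t ∈ Set.Icc 0 T, x t = a + ∫ r in (0 : ℝ)..t, y r)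
    (h2 : ∀ t ∈ Set.Icc 0 T, y t = b - ω ^ 2 * (∫ r in (0 : ℝ)..t, x r) + w t)
    {t : ℝ} (ht : t ∈ Set.Icc 0 T) :
    x t = Real.cos (ω * t) * a + oscSin ω t * b +
        ∫ r in (0 : ℝ)..t, Real.cos (ω * (t - r)) * w r ∧
      y t = -(ω * Real.sin (ω * t)) * a + Real.cos (ω * t) * b +
        (w t - ∫ r in (0 : ℝ)..t, ω * Real.sin (ω * (t - r)) * w r) := by
  have hT : 0 ≤ T := ht.1.trans ht.2
  -- Clamping the time to [0,T] makes the paths continuous on ℝ without changing any integral over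
  -- [0,t].
  set π : ℝ → ℝ := fun r => max 0 (min r T)
  have hπ : Continuous π := by fun_prop
  have hπm (r : ℝ) : π r ∈ Set.Icc 0 T := ⟨le_max_left _ _, max_le hT (min_le_right _ _)⟩
  have hπe {r : ℝ} (hr : r ∈ Set.Icc 0 T) : π r = r := by
    simp [π, min_eq_left hr.2, max_eq_right hr.1]
  have hπu {t r : ℝ} (ht : t ∈ Set.Icc 0 T) (hr : r ∈ Set.uIcc 0 t) : π r = r := by
    rw [Set.uIcc_of_le ht.1] at hr
    exact hπe ⟨hr.1, hr.2.trans ht.2⟩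
  have hI (F g : ℝ → ℝ) {t : ℝ} (ht : t ∈ Set.Icc 0 T) :
      ∫ r in (0 : ℝ)..t, F r * (g ∘ π) r = ∫ r in (0 : ℝ)..t, F r * g r :=
    intervalIntegral.integral_congr fun r hr => by simp [hπu ht hr]
  have hI1 (g : ℝ → ℝ) {t : ℝ} (ht : t ∈ Set.Icc 0 T) :
      ∫ r in (0 : ℝ)..t, (g ∘ π) r = ∫ r in (0 : ℝ)..t, g r :=
    intervalIntegral.integral_congr fun r hr => by simp [hπu ht hr]
  have hv (g : ℝ → ℝ) {t : ℝ} (ht : t ∈ Set.Icc 0 T) : (g ∘ π) t = g t := by simp [hπe ht]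
  have key := oscillator_of_continuous (T := T) (ω := ω) (a := a) (b := b)
    (hx.comp_continuous hπ hπm) (hy.comp_continuous hπ hπm) (hw.comp_continuous hπ hπm)
    (fun t ht => (hv x ht).trans ((h1 t ht).trans (by rw [← hI1 y ht])))
    (fun t ht => (hv y ht).trans ((h2 t ht).trans (by rw [← hI1 x ht, ← hv w ht]))) ht
  have key1 : (x ∘ π) t = _ + ∫ r in (0 : ℝ)..t, Real.cos (ω * (t - r)) * (w ∘ π) r := key.1
  have key2 : (y ∘ π) t = _ + ((w ∘ π) t -
    ∫ r in (0 : ℝ)..t, (fun r => ω * Real.sin (ω * (t - r))) r * (w ∘ π) r) := key.2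
  rw [hI _ _ ht, hv x ht] at key1
  rw [hI _ _ ht, hv y ht, hv w ht] at key2
  exact ⟨key1, key2⟩

/-! ### Wiener integrals of continuously differentiable functions -/

/-- The norm of a standard Gaussian random variable in `L^p`. -/
def gaussianMoment (p : ℝ≥0∞) : ℝ≥0∞ := eLpNorm id p (gaussianReal 0 1)

lemma gaussianMoment_ne_top {p : ℝ≥0∞} (hp : p ≠ ∞) : gaussianMoment p ≠ ∞ :=
  (memLp_id_gaussianReal' p hp).2.ne

lemma eLpNorm_id_gaussianReal (p : ℝ≥0∞) {v : ℝ} (hv : 0 ≤ v) :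
    eLpNorm id p (gaussianReal 0 v.toNNReal) = ENNReal.ofReal (√v) * gaussianMoment p := by
  have h := gaussianReal_map_const_mul (μ := 0) (v := 1) (√v)
  have h2 : gaussianReal (√v * 0) (.mk (√v ^ 2) (sq_nonneg _) * 1) =
      gaussianReal 0 v.toNNReal := by
    congr 1
    · simp
    · ext
      simp [Real.sq_sqrt hv, hv]
  rw [← h2, ← h, eLpNorm_map_measure (by fun_prop) (by fun_prop)]
  have h3 : (id ∘ fun x : ℝ => √v * x) = √v • id := by
    ext x; simp
  rw [h3, eLpNorm_const_smul, gaussianMoment, Real.enorm_eq_ofReal (Real.sqrt_nonneg v)]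

/-- A centered Gaussian variable is distributed as a standard one scaled by its standard deviation,
so a variance bound controls every moment. -/
lemma eLpNorm_of_hasGaussianLaw {Ω : Type*} [MeasurableSpace Ω] {P : Measure Ω} {X : Ω → ℝ}
    (hX : HasGaussianLaw X P) (h0 : ∫ ω, X ω ∂P = 0) (p : ℝ≥0∞) :
    eLpNorm X p P = ENNReal.ofReal (√(Var[X; P])) * gaussianMoment p := by
  have h := hX.map_eq_gaussianReal
  rw [h0] at h
  rw [← eLpNorm_id_gaussianReal p (variance_nonneg X P), ← h,
    eLpNorm_map_measure (by fun_prop) hX.aemeasurable]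
  rfl

section Brownian

variable {Ω : Type*} [MeasurableSpace Ω] {P : Measure Ω} {T : ℝ}
  {B : ℝ → Ω → ℝ}

lemma IsBrownianOn.hasGaussianLaw (hB : IsBrownianOn P T B) {t : ℝ} (ht : t ∈ Set.Icc 0 T) :
    HasGaussianLaw (B t) P :=
  hB.gaussian.hasGaussianLaw_eval ⟨t, ht⟩

/-- The variance at time 0 is min 0 0 = 0. This removes the lower boundary term in the partial
summation below. -/
lemma IsBrownianOn.ae_eq_zero (hB : IsBrownianOn P T B) (hT : 0 ≤ T) :
    ∀ᵐ ω ∂P, B 0 ω = 0 := by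
  have h0 : (0 : ℝ) ∈ Set.Icc 0 T := ⟨le_rfl, hT⟩
  have hG := hB.hasGaussianLaw h0
  have h := eLpNorm_of_hasGaussianLaw hG (hB.mean_zero 0 h0) 1
  have hv : Var[B 0; P] = 0 := by
    rw [← covariance_self hG.aemeasurable, hB.cov_eq 0 h0 0 h0, min_self]
  rw [hv, Real.sqrt_zero, ENNReal.ofReal_zero, zero_mul,
    eLpNorm_eq_zero_iff hG.aemeasurable.aestronglyMeasurable one_ne_zero] at h
  exact h

/-- The approximation of the Wiener integral of `f` on `[0,t]` with respect to `B` by a Riemann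
sum with `n` equidistant points. -/
def wienerSum (f : ℝ → ℝ) (t : ℝ) (B : ℝ → Ω → ℝ) (n : ℕ) (ω : Ω) : ℝ :=
  ∑ i ∈ Finset.range n, f (i * (t / n)) * (B ((i + 1 : ℕ) * (t / n)) ω - B (i * (t / n)) ω)

lemma gridPoint_mem {t : ℝ} (ht : t ∈ Set.Icc 0 T) {i n : ℕ} (h : i ≤ n) :
    (i : ℝ) * (t / n) ∈ Set.Icc 0 t ∧ (i : ℝ) * (t / n) ∈ Set.Icc 0 T := by
  have h1 : 0 ≤ (i : ℝ) * (t / n) := mul_nonneg (Nat.cast_nonneg _)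
    (div_nonneg ht.1 (Nat.cast_nonneg _))
  have h2 : (i : ℝ) * (t / n) ≤ t := by
    rcases Nat.eq_zero_or_pos n with rfl | hn
    · simpa using ht.1
    · have hn' : (0 : ℝ) < n := by exact_mod_cast hn
      rw [mul_div_assoc', div_le_iff₀ hn', mul_comm]
      exact mul_le_mul_of_nonneg_left (by exact_mod_cast h) ht.1
  exact ⟨⟨h1, h2⟩, ⟨h1, h2.trans ht.2⟩⟩

lemma IsBrownianOn.cov_increment [IsProbabilityMeasure P] (hB : IsBrownianOn P T B)
    {a b c d : ℝ} (ha : a ∈ Set.Icc 0 T)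
    (hb : b ∈ Set.Icc 0 T) (hc : c ∈ Set.Icc 0 T) (hd : d ∈ Set.Icc 0 T) :
    cov[fun ω => B b ω - B a ω, fun ω => B d ω - B c ω; P] =
      min b d - min b c - (min a d - min a c) := by
  rw [covariance_fun_sub_fun_sub (hB.hasGaussianLaw hb).memLp_two
    (hB.hasGaussianLaw ha).memLp_two (hB.hasGaussianLaw hd).memLp_two
    (hB.hasGaussianLaw hc).memLp_two, hB.cov_eq b hb d hd, hB.cov_eq b hb c hc,
    hB.cov_eq a ha d hd, hB.cov_eq a ha c hc]
  ring

lemma IsBrownianOn.hasGaussianLaw_wienerSum (hB : IsBrownianOn P T B) (f : ℝ → ℝ) {t : ℝ}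
    (ht : t ∈ Set.Icc 0 T) (n : ℕ) : HasGaussianLaw (wienerSum f t B n) P := by
  have h := hB.gaussian.hasGaussianLaw_increments (n := n)
    (t := fun i => ⟨(i : ℕ) * (t / n), (gridPoint_mem ht (Nat.lt_succ_iff.1 i.2)).2⟩)
  have h2 := h.map_fun (∑ i : Fin n, f ((i : ℕ) * (t / n)) • ContinuousLinearMap.proj i)
  refine h2.congr (ae_of_all _ fun ω => ?_)
  simp [wienerSum, Finset.sum_range]

lemma IsBrownianOn.integral_wienerSum (hB : IsBrownianOn P T B) (f : ℝ → ℝ) {t : ℝ}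
    (ht : t ∈ Set.Icc 0 T) (n : ℕ) : ∫ ω, wienerSum f t B n ω ∂P = 0 := by
  have hi {i : ℕ} (h : i ≤ n) := (gridPoint_mem ht h).2
  unfold wienerSum
  rw [integral_finsetSum]
  · refine Finset.sum_eq_zero fun i hin => ?_
    rw [Finset.mem_range] at hin
    rw [integral_const_mul, integral_sub (hB.hasGaussianLaw (hi hin)).integrable
      (hB.hasGaussianLaw (hi hin.le)).integrable, hB.mean_zero _ (hi hin),
      hB.mean_zero _ (hi hin.le)]
    simp
  · intro i hin
    rw [Finset.mem_range] at hin
    exact ((hB.hasGaussianLaw (hi hin)).integrable.sub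
      (hB.hasGaussianLaw (hi hin.le)).integrable).const_mul _

/-- Discrete Itô isometry: increments over different grid cells are uncorrelated and each has
variance t/n, so the variance is a Riemann sum of f². -/
lemma IsBrownianOn.variance_wienerSum_le [IsProbabilityMeasure P]
    (hB : IsBrownianOn P T B) {f : ℝ → ℝ} {t K : ℝ}
    (ht : t ∈ Set.Icc 0 T) (hf : ∀ r ∈ Set.Icc 0 t, |f r| ≤ K) (n : ℕ) :
    Var[wienerSum f t B n; P] ≤ K ^ 2 * t := by
  have hi {i : ℕ} (h : i ≤ n) := (gridPoint_mem ht h).2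
  have hmono {i j : ℕ} (h : i ≤ j) : (i : ℝ) * (t / n) ≤ j * (t / n) :=
    mul_le_mul_of_nonneg_right (by exact_mod_cast h) (div_nonneg ht.1 (Nat.cast_nonneg _))
  have hcov : ∀ i ∈ Finset.range n, ∀ j ∈ Finset.range n,
      cov[fun ω => f (i * (t / n)) * (B ((i + 1 : ℕ) * (t / n)) ω - B (i * (t / n)) ω),
        fun ω => f (j * (t / n)) * (B ((j + 1 : ℕ) * (t / n)) ω - B (j * (t / n)) ω); P] =
      if i = j then f (i * (t / n)) ^ 2 * (t / n) else 0 := by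
    intro i hin j hjn
    rw [Finset.mem_range] at hin hjn
    rw [covariance_const_mul_left, covariance_const_mul_right,
      hB.cov_increment (hi hin.le) (hi hin) (hi hjn.le) (hi hjn)]
    rcases lt_trichotomy i j with h | rfl | h
    · rw [if_neg h.ne, min_eq_left (hmono (by omega)), min_eq_left (hmono (by omega)),
        min_eq_left (hmono (by omega)), min_eq_left (hmono h.le)]
      simp
    · rw [if_pos rfl, min_self, min_self, min_eq_right (hmono (Nat.le_succ i)),
        min_eq_left (hmono (Nat.le_succ i))]
      push_cast
      ring
    · rw [if_neg h.ne', min_eq_right (hmono (by omega)), min_eq_right (hmono (by omega)),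
        min_eq_right (hmono (by omega)), min_eq_right (hmono h.le)]
      simp
  have hS : wienerSum f t B n = ∑ i ∈ Finset.range n, fun ω =>
      f (i * (t / n)) * (B ((i + 1 : ℕ) * (t / n)) ω - B (i * (t / n)) ω) := by
    ext ω
    simp [wienerSum]
  have hmem : ∀ i ∈ Finset.range n, MemLp (fun ω =>
      f (i * (t / n)) * (B ((i + 1 : ℕ) * (t / n)) ω - B (i * (t / n)) ω)) 2 P := by
    intro i hin
    rw [Finset.mem_range] at hin
    exact ((hB.hasGaussianLaw (hi hin)).memLp_two.sub
      (hB.hasGaussianLaw (hi hin.le)).memLp_two).const_mul _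
  rw [hS, variance_sum' hmem, Finset.sum_congr rfl fun i hin => Finset.sum_congr rfl (hcov i hin)]
  have hle : ∀ i ∈ Finset.range n, (∑ j ∈ Finset.range n,
      if i = j then f (i * (t / n)) ^ 2 * (t / n) else 0) ≤ K ^ 2 * (t / n) := by
    intro i hin
    rw [Finset.sum_ite_eq, if_pos hin]
    refine mul_le_mul_of_nonneg_right ?_ (div_nonneg ht.1 (Nat.cast_nonneg _))
    rw [← sq_abs]
    exact pow_le_pow_left₀ (abs_nonneg _)
      (hf _ (gridPoint_mem ht (Finset.mem_range.1 hin).le).1) 2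
  refine (Finset.sum_le_sum hle).trans ?_
  rw [Finset.sum_const, Finset.card_range, nsmul_eq_mul]
  rcases Nat.eq_zero_or_pos n with rfl | hn
  · simpa using mul_nonneg (sq_nonneg K) ht.1
  · have : (n : ℝ) ≠ 0 := by positivity
    apply le_of_eq
    field_simp

/-- The Wiener integral of `f` on `[0,t]`, defined by partial integration. -/
def wienerIntegral (f f' : ℝ → ℝ) (t : ℝ) (B : ℝ → Ω → ℝ) (ω : Ω) : ℝ :=
  f t * B t ω - ∫ r in (0 : ℝ)..t, f' r * B r ω

lemma sum_mul_sub_eq (f b : ℕ → ℝ) (n : ℕ) :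
    ∑ i ∈ Finset.range n, f i * (b (i + 1) - b i) =
      f n * b n - f 0 * b 0 - ∑ i ∈ Finset.range n, (f (i + 1) - f i) * b (i + 1) := by
  induction n with
  | zero => simp
  | succ n ih =>
    rw [Finset.sum_range_succ, Finset.sum_range_succ, ih]
    ring

/-- Convergence of Riemann--Stieltjes sums. -/
lemma tendsto_sum_mul_sub {f f' b : ℝ → ℝ} {t : ℝ} (ht : 0 ≤ t)
    (hf : ∀ r, HasDerivAt f (f' r) r) (hf' : Continuous f') (hb : ContinuousOn b (Set.Icc 0 t))
    (hb0 : b 0 = 0) :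
    Tendsto (fun n : ℕ => ∑ i ∈ Finset.range n,
      f (i * (t / n)) * (b ((i + 1 : ℕ) * (t / n)) - b (i * (t / n)))) atTop
      (𝓝 (f t * b t - ∫ r in (0 : ℝ)..t, f' r * b r)) := by
  obtain ⟨M, hM⟩ := isCompact_Icc.exists_bound_of_continuousOn
    (hf'.continuousOn (s := Set.Icc 0 t))
  have hM0 : 0 ≤ M := (norm_nonneg _).trans (hM 0 ⟨le_rfl, ht⟩)
  rw [Metric.tendsto_atTop]
  intro ε hε
  -- The total error will be at most M t η; the added 1 makes the final inequality strict and avoids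
  -- division by zero.
  set η : ℝ := ε / (M * t + 1) with hη
  have hden : 0 < M * t + 1 := by positivity
  have hηpos : 0 < η := div_pos hε hden
  obtain ⟨δ, hδ, huc⟩ := Metric.uniformContinuousOn_iff.1
    (isCompact_Icc.uniformContinuousOn_of_continuous hb) η hηpos
  obtain ⟨N, hN⟩ := exists_nat_gt (t / δ)
  refine ⟨N + 1, fun n hn => ?_⟩
  have hn0 : (0 : ℝ) < n := by
    have : 0 < n := by omega
    exact_mod_cast this
  have hstep : t / n < δ := by
    rw [div_lt_iff₀ hn0]
    rw [div_lt_iff₀ hδ] at hN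
    have : (N : ℝ) ≤ n := by exact_mod_cast (by omega : N ≤ n)
    nlinarith
  have htT : t ∈ Set.Icc 0 t := ⟨ht, le_rfl⟩
  set r : ℕ → ℝ := fun i => i * (t / n) with hr
  have hr0 : r 0 = 0 := by simp [hr]
  have hrn : r n = t := by simp only [hr]; field_simp
  have hrs (i : ℕ) : r (i + 1) - r i = t / n := by simp only [hr]; push_cast; ring
  have hrm {i : ℕ} (hi : i ≤ n) : r i ∈ Set.Icc 0 t := (gridPoint_mem htT hi).1
  have hrle (i : ℕ) : r i ≤ r (i + 1) := by
    have := hrs i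
    have : 0 ≤ t / n := by positivity
    linarith
  have hsubset {i : ℕ} (hi : i < n) : Set.uIcc (r i) (r (i + 1)) ⊆ Set.Icc 0 t := by
    rw [Set.uIcc_of_le (hrle i)]
    exact Set.Icc_subset_Icc (hrm hi.le).1 (hrm hi).2
  have hint1 {i : ℕ} (hi : i < n) :
      IntervalIntegrable (fun s => f' s * b s) volume (r i) (r (i + 1)) :=
    ((hf'.continuousOn.mul hb).mono (hsubset hi)).intervalIntegrable
  have hint2 (i : ℕ) :
      IntervalIntegrable (fun s => f' s * b (r (i + 1))) volume (r i) (r (i + 1)) :=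
    (hf'.mul continuous_const).intervalIntegrable _ _
  -- After summation by parts, each increment of f is an integral of f', with b frozen at the right
  -- endpoint of the cell. The error is then governed by the oscillation of b on one cell.
  have e1 : ∑ i ∈ Finset.range n, f (r i) * (b (r (i + 1)) - b (r i)) =
      f t * b t - ∑ i ∈ Finset.range n, ∫ s in r i..r (i + 1), f' s * b (r (i + 1)) := by
    rw [sum_mul_sub_eq (fun i => f (r i)) (fun i => b (r i)), hr0, hb0, hrn]
    have : ∀ i, (∫ s in r i..r (i + 1), f' s * b (r (i + 1))) =
        (f (r (i + 1)) - f (r i)) * b (r (i + 1)) := by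
      intro i
      rw [intervalIntegral.integral_mul_const, intervalIntegral.integral_eq_sub_of_hasDerivAt
        (fun x _ => hf x) (hf'.intervalIntegrable _ _)]
    simp only [this]
    ring
  have e2 : ∫ s in (0 : ℝ)..t, f' s * b s =
      ∑ i ∈ Finset.range n, ∫ s in r i..r (i + 1), f' s * b s := by
    rw [intervalIntegral.sum_integral_adjacent_intervals (a := r) (n := n)
      fun k hk => hint1 hk, hr0, hrn]
  change dist (∑ i ∈ Finset.range n, f (r i) * (b (r (i + 1)) - b (r i))) _ < ε
  rw [e1, e2, Real.dist_eq]
  have e3 : (f t * b t - ∑ i ∈ Finset.range n, ∫ s in r i..r (i + 1), f' s * b (r (i + 1))) -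
      (f t * b t - ∑ i ∈ Finset.range n, ∫ s in r i..r (i + 1), f' s * b s) =
      ∑ i ∈ Finset.range n, ∫ s in r i..r (i + 1), f' s * (b s - b (r (i + 1))) := by
    rw [sub_sub_sub_cancel_left, ← Finset.sum_sub_distrib]
    refine Finset.sum_congr rfl fun i hi => ?_
    rw [← intervalIntegral.integral_sub (hint1 (Finset.mem_range.1 hi)) (hint2 i)]
    simp only [mul_sub]
  rw [e3]
  have hb1 : ∀ i ∈ Finset.range n,
      |∫ s in r i..r (i + 1), f' s * (b s - b (r (i + 1)))| ≤ M * η * (t / n) := by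
    intro i hi
    rw [Finset.mem_range] at hi
    have := intervalIntegral.norm_integral_le_of_norm_le_const (a := r i) (b := r (i + 1))
      (f := fun s => f' s * (b s - b (r (i + 1)))) (C := M * η) (fun s hs => by
        have hs' := Set.uIoc_subset_uIcc hs
        have hs1 := hsubset hi hs'
        rw [Set.uIcc_of_le (hrle i)] at hs'
        rw [norm_mul]
        refine mul_le_mul (hM s hs1) ?_ (norm_nonneg _) hM0
        have := huc s hs1 (r (i + 1)) (hrm hi) (by
          rw [Real.dist_eq, abs_sub_comm, abs_of_nonneg (by linarith [hs'.2])]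
          linarith [hrs i, hs'.1])
        rw [Real.dist_eq] at this
        exact this.le)
    rwa [hrs, abs_of_nonneg (by positivity : 0 ≤ t / n)] at this
  calc |∑ i ∈ Finset.range n, ∫ s in r i..r (i + 1), f' s * (b s - b (r (i + 1)))|
      ≤ ∑ i ∈ Finset.range n, M * η * (t / n) :=
        (Finset.abs_sum_le_sum_abs _ _).trans (Finset.sum_le_sum hb1)
    _ = M * t * η := by
        rw [Finset.sum_const, Finset.card_range, nsmul_eq_mul]
        field_simp
    _ < (M * t + 1) * η := by nlinarith
    _ = ε := by rw [hη]; field_simp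

lemma IsBrownianOn.ae_tendsto_wienerSum (hB : IsBrownianOn P T B) {f f' : ℝ → ℝ}
    (hf : ∀ r, HasDerivAt f (f' r) r) (hf' : Continuous f') {t : ℝ} (ht : t ∈ Set.Icc 0 T) :
    ∀ᵐ ω ∂P, Tendsto (fun n => wienerSum f t B n ω) atTop (𝓝 (wienerIntegral f f' t B ω)) := by
  filter_upwards [hB.ae_eq_zero (ht.1.trans ht.2), hB.continuous_paths] with ω h0 hc
  exact tendsto_sum_mul_sub (b := fun t => B t ω) ht.1 hf hf'
    (hc.mono (Set.Icc_subset_Icc le_rfl ht.2)) h0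

lemma IsBrownianOn.aestronglyMeasurable_wienerIntegral (hB : IsBrownianOn P T B) {f f' : ℝ → ℝ}
    (hf : ∀ r, HasDerivAt f (f' r) r) (hf' : Continuous f') {t : ℝ} (ht : t ∈ Set.Icc 0 T) :
    AEStronglyMeasurable (wienerIntegral f f' t B) P :=
  aestronglyMeasurable_of_tendsto_ae atTop
    (fun n => (hB.hasGaussianLaw_wienerSum f ht n).aemeasurable.aestronglyMeasurable)
    (hB.ae_tendsto_wienerSum hf hf' ht)

/-- The moments of a Wiener integral. -/
lemma IsBrownianOn.eLpNorm_wienerIntegral_le [IsProbabilityMeasure P]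
    (hB : IsBrownianOn P T B) {f f' : ℝ → ℝ}
    (hf : ∀ r, HasDerivAt f (f' r) r) (hf' : Continuous f') {t K : ℝ} (ht : t ∈ Set.Icc 0 T)
    (hK : ∀ r ∈ Set.Icc 0 t, |f r| ≤ K) (p : ℝ≥0∞) :
    eLpNorm (wienerIntegral f f' t B) p P ≤ ENNReal.ofReal (K * √T) * gaussianMoment p := by
  -- Fatou's lemma transfers the uniform bound on the Gaussian sums to their almost sure limit.
  refine (Lp.eLpNorm_lim_le_liminf_eLpNorm
    (fun n => (hB.hasGaussianLaw_wienerSum f ht n).aemeasurable.aestronglyMeasurable) _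
    (hB.ae_tendsto_wienerSum hf hf' ht)).trans ?_
  have hK0 : 0 ≤ K := (abs_nonneg _).trans (hK 0 ⟨le_rfl, ht.1⟩)
  have hle : ∀ n, eLpNorm (wienerSum f t B n) p P ≤
      ENNReal.ofReal (K * √T) * gaussianMoment p := by
    intro n
    rw [eLpNorm_of_hasGaussianLaw (hB.hasGaussianLaw_wienerSum f ht n)
      (hB.integral_wienerSum f ht n)]
    gcongr
    rw [← Real.sqrt_sq hK0, ← Real.sqrt_mul (sq_nonneg K)]
    apply Real.sqrt_le_sqrt
    exact (hB.variance_wienerSum_le ht hK n).trans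
      (mul_le_mul_of_nonneg_left ht.2 (sq_nonneg K))
  exact (liminf_le_liminf (Eventually.of_forall hle)).trans (liminf_const _).le

end Brownian

/-! ### Random orthogonal series -/

lemma eLpNorm_sq {Ω E : Type*} [MeasurableSpace Ω] {P : Measure Ω} [NormedAddCommGroup E]
    (X : Ω → E) (m : ℕ) :
    eLpNorm (fun ω => ‖X ω‖ ^ 2) m P = eLpNorm X (2 * m) P ^ 2 := by
  have h := eLpNorm_norm_rpow (μ := P) (p := m) X (zero_lt_two' ℝ)
  simp only [Real.rpow_two, ENNReal.ofReal_ofNat, ENNReal.rpow_two] at h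
  rw [h, mul_comm]

section Series

variable {Ω ι E : Type*} [MeasurableSpace Ω] {P : Measure Ω}
  [NormedAddCommGroup E] [InnerProductSpace ℝ E] {e : ι → E}

/-- The moments of a finite orthogonal sum with random coefficients. -/
lemma eLpNorm_sum_smul_sq_le (he : Orthonormal ℝ e) {c : ι → Ω → ℝ}
    (hc : ∀ k, AEStronglyMeasurable (c k) P) {m : ℕ} (hm : 1 ≤ m) (s : Finset ι) :
    eLpNorm (fun ω => ∑ k ∈ s, c k ω • e k) (2 * m) P ^ 2 ≤
      ∑ k ∈ s, eLpNorm (c k) (2 * m) P ^ 2 := by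
  have h : (fun ω => ‖∑ k ∈ s, c k ω • e k‖ ^ 2) = ∑ k ∈ s, fun ω => ‖c k ω‖ ^ 2 := by
    ext ω
    rw [← real_inner_self_eq_norm_sq, he.inner_sum]
    simp [sq]
  -- By Pythagoras, the squared L^{2m} norm is the L^m norm of a sum of squares, and the triangle
  -- inequality in L^m applies since m ≥ 1.
  rw [← eLpNorm_sq, h]
  simp only [← eLpNorm_sq]
  exact eLpNorm_sum_le (fun k _ => (hc k).norm.pow 2) (by exact_mod_cast hm)

/-- On a probability space the L² norm is at most the L^{2m} norm, so the sum of squares has finite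
expectation. -/
lemma ae_summable_sq [IsProbabilityMeasure P] [Countable ι] {c : ι → Ω → ℝ}
    (hc : ∀ k, AEStronglyMeasurable (c k) P) {m : ℕ} (hm : 1 ≤ m)
    (hfin : ∑' k, eLpNorm (c k) (2 * m) P ^ 2 ≠ ∞) :
    ∀ᵐ ω ∂P, Summable fun k => ‖c k ω‖ ^ 2 := by
  have h1 : ∫⁻ ω, ∑' k, ‖c k ω‖ₑ ^ 2 ∂P ≠ ∞ := by
    rw [lintegral_tsum fun k => (hc k).enorm.pow_const 2]
    refine ne_top_of_le_ne_top hfin (ENNReal.tsum_le_tsum fun k => ?_)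
    have h2 : (2 : ℝ≥0∞) ≤ 2 * m := by
      refine le_mul_of_one_le_right (by simp) (by exact_mod_cast hm)
    refine le_trans (le_of_eq ?_)
      (pow_le_pow_left' (eLpNorm_le_eLpNorm_of_exponent_le h2 (hc k)) 2)
    rw [eLpNorm_eq_lintegral_rpow_enorm_toReal two_ne_zero ENNReal.ofNat_ne_top,
      ← ENNReal.rpow_two, ← ENNReal.rpow_mul]
    simp
  filter_upwards [ae_lt_top' (AEMeasurable.tsum fun k => (hc k).enorm.pow_const 2) h1]
    with ω hω
  have := ENNReal.summable_toReal hω.ne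
  simpa using this

/-- Orthogonal series with random coefficients converge in `L^p`. -/
lemma exists_memLp_inner_eq [CompleteSpace E] [IsProbabilityMeasure P] [Countable ι]
    (he : Orthonormal ℝ e) {c : ι → Ω → ℝ} (hc : ∀ k, AEStronglyMeasurable (c k) P)
    {m : ℕ} (hm : 1 ≤ m) {R : ℝ≥0∞} (hR : R ≠ ∞)
    (hfin : ∑' k, eLpNorm (c k) (2 * m) P ^ 2 ≤ R ^ 2) :
    ∃ G : Ω → E, MemLp G (2 * m) P ∧ eLpNorm G (2 * m) P ≤ R ∧
      ∀ᵐ ω ∂P, ∀ k, inner ℝ (e k) (G ω) = c k ω := by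
  have hsum : ∀ᵐ ω ∂P, HasSum (fun k => c k ω • e k) (∑' k, c k ω • e k) := by
    filter_upwards [ae_summable_sq hc hm (ne_top_of_le_ne_top (ENNReal.pow_ne_top hR) hfin)]
      with ω hω
    refine Summable.hasSum ?_
    have := (he.orthogonalFamily.summable_iff_norm_sq_summable fun k => c k ω).2 hω
    simpa using this
  -- A sequence of finite sets exhausting the index set: measurability of the limit and Fatou's
  -- lemma are applied along sequences.
  obtain ⟨s, hs⟩ := exists_seq_tendsto (atTop : Filter (Finset ι))
  have hlim : ∀ᵐ ω ∂P, Tendsto (fun n => ∑ k ∈ s n, c k ω • e k) atTop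
      (𝓝 (∑' k, c k ω • e k)) := by
    filter_upwards [hsum] with ω hω
    have h : Tendsto (fun t : Finset ι => ∑ k ∈ t, c k ω • e k) atTop
        (𝓝 (∑' k, c k ω • e k)) := hω
    exact h.comp hs
  have hmeas (n : ℕ) : AEStronglyMeasurable (fun ω => ∑ k ∈ s n, c k ω • e k) P :=
    Finset.aestronglyMeasurable_fun_sum _ fun k _ => (hc k).smul_const _
  have hle : eLpNorm (fun ω => ∑' k, c k ω • e k) (2 * m) P ≤ R := by
    refine (Lp.eLpNorm_lim_le_liminf_eLpNorm hmeas _ hlim).trans ?_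
    refine (liminf_le_liminf (Eventually.of_forall fun n => ?_)).trans (liminf_const R).le
    rw [← ENNReal.pow_le_pow_left_iff two_ne_zero]
    exact (eLpNorm_sum_smul_sq_le he hc hm (s n)).trans ((ENNReal.sum_le_tsum _).trans hfin)
  refine ⟨fun ω => ∑' k, c k ω • e k,
    ⟨aestronglyMeasurable_of_tendsto_ae atTop hmeas hlim, hle.trans_lt hR.lt_top⟩, hle, ?_⟩
  classical
  filter_upwards [hsum] with ω hω k
  have h1 := (innerSL ℝ (e k)).hasSum hω
  have h2 : HasSum (fun j => innerSL ℝ (e k) (c j ω • e j)) (c k ω) := by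
    convert hasSum_ite_eq k (c k ω) using 2 with j
    simp only [innerSL_apply_apply, inner_smul_right, orthonormal_iff_ite.1 he k j]
    by_cases h : j = k
    · simp [h]
    · simp [h, Ne.symm h]
  exact h1.unique h2

end Series

/-! ### Sobolev norms in terms of coefficients -/

/-- The eigenvalue of `Id - Δ` on the spherical harmonics of degree `ℓ`. -/
def eig (ℓ : ℕ) : ℝ := 1 + (ℓ : ℝ) * ((ℓ : ℝ) + 1)

lemma one_le_eig (ℓ : ℕ) : 1 ≤ eig ℓ := by
  unfold eig
  have : 0 ≤ (ℓ : ℝ) * ((ℓ : ℝ) + 1) := by positivity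
  linarith

lemma eig_pos (ℓ : ℕ) : 0 < eig ℓ := zero_lt_one.trans_le (one_le_eig ℓ)

/-- The coefficients of `(Id - Δ)^{s/2} f`. -/
def besselCoeff (s : ℝ) (f : GenFun) (k : HarmIndex) : ℝ :=
  eig k.1.1 ^ (s / 2) * f (harmTest k)

lemma isBesselPotential_iff {s : ℝ} {f : GenFun} {g : L2S2} :
    IsBesselPotential s f g ↔ ∀ k, inner ℝ (harmLp k) g = besselCoeff s f k := by
  simp only [inner_harmLp]
  rfl

/-- Bessel's inequality for every admissible potential; if there is none, the right side is
infinite. -/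
lemma tsum_besselCoeff_sq_le (s : ℝ) (f : GenFun) :
    ∑' k, ‖besselCoeff s f k‖ₑ ^ 2 ≤ sobolevNorm s f ^ 2 := by
  have h : ∀ g, IsBesselPotential s f g → ∑' k, ‖besselCoeff s f k‖ₑ ^ 2 ≤ ‖g‖ₑ ^ 2 := by
    intro g hg
    rw [isBesselPotential_iff] at hg
    rw [ENNReal.tsum_eq_iSup_sum]
    refine iSup_le fun t => ?_
    have := orthonormal_harmLp.sum_inner_products_le (s := t) g
    simp only [hg] at this
    have h2 := ENNReal.ofReal_le_ofReal this
    rw [ENNReal.ofReal_sum_of_nonneg fun _ _ => sq_nonneg _] at h2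
    simpa only [ENNReal.ofReal_pow (norm_nonneg _), ofReal_norm] using h2
  rw [← ENNReal.rpow_two, ← ENNReal.rpow_inv_le_iff two_pos]
  refine le_iInf₂ fun g hg => ?_
  rw [ENNReal.rpow_inv_le_iff two_pos, ENNReal.rpow_two]
  exact h g hg

lemma MemSobolev.sobolevNorm_ne_top {s : ℝ} {f : GenFun} (h : MemSobolev s f) :
    sobolevNorm s f ≠ ∞ := by
  obtain ⟨g, hg⟩ := h
  exact ne_top_of_le_ne_top enorm_ne_top (iInf₂_le g hg)

lemma add_sq_le_four_mul_add (x y : ℝ≥0∞) : (x + y) ^ 2 ≤ 4 * x ^ 2 + 4 * y ^ 2 := by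
  rcases le_total x y with h | h
  · calc (x + y) ^ 2 ≤ (y + y) ^ 2 := by gcongr
      _ = 4 * y ^ 2 := by ring
      _ ≤ _ := le_add_self
  · calc (x + y) ^ 2 ≤ (x + x) ^ 2 := by gcongr
      _ = 4 * x ^ 2 := by ring
      _ ≤ _ := le_self_add

lemma add_add_sq_le_sixteen_mul_add (x y z : ℝ≥0∞) :
    (x + y + z) ^ 2 ≤ 16 * (x ^ 2 + y ^ 2 + z ^ 2) :=
  calc (x + y + z) ^ 2 ≤ 4 * (x + y) ^ 2 + 4 * z ^ 2 := add_sq_le_four_mul_add _ _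
    _ ≤ 4 * (4 * x ^ 2 + 4 * y ^ 2) + 4 * (4 * z ^ 2) := by
        gcongr
        · exact add_sq_le_four_mul_add x y
        · exact le_mul_of_one_le_left (by simp) (by norm_num)
    _ = 16 * (x ^ 2 + y ^ 2 + z ^ 2) := by ring

/-- Moment bounds in Sobolev spaces from bounds for the coefficients. -/
lemma memLpSobolev_of_coeff {Ω : Type*} [MeasurableSpace Ω] {P : Measure Ω}
    [IsProbabilityMeasure P] {m : ℕ} (hm : 1 ≤ m) {s s₁ s₂ K : ℝ} {Z : Ω → GenFun}
    {v₁ v₂ : GenFun} (hv₁ : MemSobolev s₁ v₁) (hv₂ : MemSobolev s₂ v₂)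
    {a b : HarmIndex → ℝ} {X : HarmIndex → Ω → ℝ} {x : HarmIndex → ℝ≥0∞}
    (ha : ∀ k, |a k| ≤ K) (hb : ∀ k, |b k| ≤ K) (hX : ∀ k, AEStronglyMeasurable (X k) P)
    (hx : ∀ k, eLpNorm (X k) (2 * m) P ≤ ENNReal.ofReal K * x k)
    (hfin : ∑' k, x k ^ 2 ≠ ∞)
    (hZ : ∀ k, ∀ᵐ ω ∂P, besselCoeff s (Z ω) k =
      a k * besselCoeff s₁ v₁ k + b k * besselCoeff s₂ v₂ k + X k ω) :
    MemLpSobolev P (2 * m) s Z ∧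
      lpSobolevNorm P (2 * m) s Z ≤ 4 * ENNReal.ofReal K * (1 + ∑' k, x k ^ 2) *
        (1 + sobolevNorm s₁ v₁ + sobolevNorm s₂ v₂) := by
  set Q := ∑' k, x k ^ 2
  set N₁ := sobolevNorm s₁ v₁ with hN₁
  set N₂ := sobolevNorm s₂ v₂ with hN₂
  have hp : (1 : ℝ≥0∞) ≤ 2 * m := by exact_mod_cast (by omega : 1 ≤ 2 * m)
  have hR : 4 * ENNReal.ofReal K * (1 + Q) * (1 + N₁ + N₂) ≠ ∞ := by
    refine ENNReal.mul_ne_top (ENNReal.mul_ne_top (ENNReal.mul_ne_top (by simp) (by simp)) ?_) ?_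
    · simpa using hfin
    · simpa using ⟨hv₁.sobolevNorm_ne_top, hv₂.sobolevNorm_ne_top⟩
  set c : HarmIndex → Ω → ℝ := fun k ω =>
    a k * besselCoeff s₁ v₁ k + b k * besselCoeff s₂ v₂ k + X k ω
  have hc (k : HarmIndex) : eLpNorm (c k) (2 * m) P ≤ ENNReal.ofReal K *
      (‖besselCoeff s₁ v₁ k‖ₑ + ‖besselCoeff s₂ v₂ k‖ₑ + x k) := by
    have h1 : c k = (fun _ => a k * besselCoeff s₁ v₁ k + b k * besselCoeff s₂ v₂ k) + X k := rfl
    rw [h1]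
    refine (eLpNorm_add_le aestronglyMeasurable_const (hX k) hp).trans ?_
    rw [mul_add]
    refine add_le_add ?_ (hx k)
    rw [eLpNorm_const _ (by positivity) (NeZero.ne P)]
    simp only [measure_univ, ENNReal.one_rpow, mul_one]
    refine (enorm_add_le _ _).trans ?_
    rw [mul_add, enorm_mul, enorm_mul]
    gcongr
    · rw [← ofReal_norm]; exact ENNReal.ofReal_le_ofReal (ha k)
    · rw [← ofReal_norm]; exact ENNReal.ofReal_le_ofReal (hb k)
  -- The square root of 16, from the square of a three-term sum, is the constant 4. The factors 1 +
  -- Q and 1 + N₁ + N₂ turn the sum N₁² + N₂² + Q into a product.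
  have hsum : ∑' k, eLpNorm (c k) (2 * m) P ^ 2 ≤
      (4 * ENNReal.ofReal K * (1 + Q) * (1 + N₁ + N₂)) ^ 2 :=
    calc ∑' k, eLpNorm (c k) (2 * m) P ^ 2
        ≤ ∑' k, 16 * ENNReal.ofReal K ^ 2 * (‖besselCoeff s₁ v₁ k‖ₑ ^ 2 +
            ‖besselCoeff s₂ v₂ k‖ₑ ^ 2 + x k ^ 2) := by
          refine ENNReal.tsum_le_tsum fun k => (pow_le_pow_left' (hc k) 2).trans ?_
          rw [mul_pow, mul_comm 16, mul_assoc]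
          gcongr
          exact add_add_sq_le_sixteen_mul_add _ _ _
      _ = 16 * ENNReal.ofReal K ^ 2 * (∑' k, ‖besselCoeff s₁ v₁ k‖ₑ ^ 2 +
            ∑' k, ‖besselCoeff s₂ v₂ k‖ₑ ^ 2 + Q) := by
          rw [ENNReal.tsum_mul_left, ENNReal.tsum_add, ENNReal.tsum_add]
      _ ≤ 16 * ENNReal.ofReal K ^ 2 * (N₁ ^ 2 + N₂ ^ 2 + Q) := by
          gcongr
          · exact tsum_besselCoeff_sq_le s₁ v₁
          · exact tsum_besselCoeff_sq_le s₂ v₂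
      _ ≤ 16 * ENNReal.ofReal K ^ 2 * ((1 + Q) ^ 2 * (1 + N₁ + N₂) ^ 2) := by
          gcongr
          have h1 : N₁ ^ 2 + N₂ ^ 2 + 1 ≤ (1 + N₁ + N₂) ^ 2 := by
            have : (1 + N₁ + N₂) ^ 2 =
                (N₁ ^ 2 + N₂ ^ 2 + 1) + (2 * N₁ + 2 * N₂ + 2 * N₁ * N₂) := by ring
            rw [this]
            exact le_self_add
          refine le_trans ?_ (mul_le_mul_right h1 _)
          have : (1 + Q) ^ 2 * (N₁ ^ 2 + N₂ ^ 2 + 1) = (N₁ ^ 2 + N₂ ^ 2 + Q) +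
              (1 + Q + Q ^ 2 + (2 * Q + Q ^ 2) * (N₁ ^ 2 + N₂ ^ 2)) := by ring
          rw [this]
          exact le_self_add
      _ = _ := by ring
  have hcm (k : HarmIndex) : AEStronglyMeasurable (c k) P :=
    aestronglyMeasurable_const.add (hX k)
  obtain ⟨G, hG, hGle, hGc⟩ := exists_memLp_inner_eq orthonormal_harmLp hcm hm hR hsum
  have hB : ∀ᵐ ω ∂P, IsBesselPotential s (Z ω) (G ω) := by
    filter_upwards [hGc, ae_all_iff.2 hZ] with ω h1 h2
    rw [isBesselPotential_iff]
    intro k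
    rw [h1 k, h2 k]
  refine ⟨⟨G, hG, hB⟩, le_trans ?_ hGle⟩
  refine eLpNorm_mono_enorm_ae ?_
  filter_upwards [hB] with ω hω
  exact iInf₂_le (G ω) hω

/-! ### Summability of the angular power spectrum -/

/-- Since ℓ² ≤ `eig ℓ` ≤ 3ℓ² for ℓ ≥ 1, the terms are eventually bounded by a multiple of
ℓ^{2σ-1-α}, and this exponent is below -1 exactly when σ < α/2. -/
lemma summable_eig_rpow_mul {A : ℕ → ℝ} (hA : ∀ ℓ, 0 ≤ A ℓ) {ℓ₀ : ℕ} {α C σ : ℝ}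
    (hdecay : ∀ ℓ : ℕ, ℓ₀ < ℓ → A ℓ ≤ C * (ℓ : ℝ) ^ (-α)) (hσ : σ < α / 2) :
    Summable fun ℓ : ℕ => (2 * (ℓ : ℝ) + 1) * (eig ℓ ^ (σ - 1) * A ℓ) := by
  have h1 : Summable fun ℓ : ℕ => (3 * max 1 (3 ^ (σ - 1)) * C) * (ℓ : ℝ) ^ (2 * σ - 1 - α) :=
    (Real.summable_nat_rpow.2 (by linarith)).mul_left _
  refine Summable.of_norm_bounded_eventually_nat h1 ?_
  filter_upwards [eventually_gt_atTop ℓ₀, eventually_ge_atTop 1] with ℓ h0 hℓ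
  have hℓ1 : (1 : ℝ) ≤ ℓ := by exact_mod_cast hℓ
  have hℓ0 : (0 : ℝ) < ℓ := by linarith
  have hpos : 0 ≤ eig ℓ ^ (σ - 1) := Real.rpow_nonneg (eig_pos ℓ).le _
  have heig1 : (ℓ : ℝ) ^ (2 : ℝ) ≤ eig ℓ := by
    rw [Real.rpow_two, eig]; nlinarith
  have heig2 : eig ℓ ≤ 3 * (ℓ : ℝ) ^ (2 : ℝ) := by
    rw [Real.rpow_two, eig]; nlinarith
  have hsq : (0 : ℝ) < (ℓ : ℝ) ^ (2 : ℝ) := by positivity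
  have hpow : eig ℓ ^ (σ - 1) ≤ max 1 (3 ^ (σ - 1)) * (ℓ : ℝ) ^ (2 * (σ - 1)) := by
    rw [Real.rpow_mul hℓ0.le]
    -- The sign of the exponent decides which of the two bounds on `eig ℓ` gives an upper bound.
    rcases le_total 0 (σ - 1) with h | h
    · refine (Real.rpow_le_rpow (eig_pos ℓ).le heig2 h).trans ?_
      rw [Real.mul_rpow (by norm_num) hsq.le]
      gcongr
      exact le_max_right _ _
    · refine (Real.rpow_le_rpow_of_nonpos hsq heig1 h).trans ?_
      exact le_mul_of_one_le_left (by positivity) (le_max_left _ _)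
  rw [Real.norm_eq_abs, abs_of_nonneg (by have := hA ℓ; positivity)]
  calc (2 * (ℓ : ℝ) + 1) * (eig ℓ ^ (σ - 1) * A ℓ)
      ≤ (3 * (ℓ : ℝ)) * ((max 1 (3 ^ (σ - 1)) * (ℓ : ℝ) ^ (2 * (σ - 1))) *
          (C * (ℓ : ℝ) ^ (-α))) := by
        refine mul_le_mul (by linarith) ?_ (mul_nonneg hpos (hA ℓ)) (by positivity)
        exact mul_le_mul hpow (hdecay ℓ h0) (hA ℓ) (by positivity)
    _ = (3 * max 1 (3 ^ (σ - 1)) * C) *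
          ((ℓ : ℝ) ^ (1 : ℝ) * (ℓ : ℝ) ^ (2 * (σ - 1)) * (ℓ : ℝ) ^ (-α)) := by
        rw [Real.rpow_one]; ring
    _ = _ := by
        rw [← Real.rpow_add hℓ0, ← Real.rpow_add hℓ0]
        congr 2
        ring

lemma tsum_harmIndex (f : ℕ → ℝ≥0∞) :
    ∑' k : HarmIndex, f k.1.1 = ∑' ℓ : ℕ, (2 * (ℓ : ℝ≥0∞) + 1) * f ℓ := by
  have h := tsum_subtype {k : ℕ × ℤ | |k.2| ≤ (k.1 : ℤ)} (fun k => f k.1)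
  refine h.trans ?_
  rw [ENNReal.tsum_prod']
  refine tsum_congr fun ℓ => ?_
  rw [tsum_eq_sum (s := Finset.Icc (-(ℓ : ℤ)) ℓ)]
  · rw [Finset.sum_congr rfl (g := fun _ => f ℓ)]
    · rw [Finset.sum_const, Int.card_Icc, nsmul_eq_mul]
      congr 1
      have : ((ℓ : ℤ) + 1 - -(ℓ : ℤ)).toNat = 2 * ℓ + 1 := by omega
      rw [this]
      push_cast
      rfl
    · intro m hm
      rw [Finset.mem_Icc] at hm
      exact Set.indicator_of_mem (by simpa [abs_le] using hm) _
  · intro m hm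
    rw [Finset.mem_Icc] at hm
    exact Set.indicator_of_notMem (by simpa [abs_le] using hm) _

lemma tsum_harmIndex_spectrum_ne_top {A : ℕ → ℝ} (hA : ∀ ℓ, 0 ≤ A ℓ) {ℓ₀ : ℕ} {α C σ : ℝ}
    (hdecay : ∀ ℓ : ℕ, ℓ₀ < ℓ → A ℓ ≤ C * (ℓ : ℝ) ^ (-α)) (hσ : σ < α / 2) :
    ∑' k : HarmIndex, ENNReal.ofReal (eig k.1.1 ^ (σ - 1) * A k.1.1) ≠ ∞ := by
  rw [tsum_harmIndex fun ℓ => ENNReal.ofReal (eig ℓ ^ (σ - 1) * A ℓ)]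
  convert (summable_eig_rpow_mul hA hdecay hσ).tsum_ofReal_ne_top using 3 with ℓ
  rw [ENNReal.ofReal_mul (p := 2 * (ℓ : ℝ) + 1) (by positivity),
    ENNReal.ofReal_add (by positivity) zero_le_one, ENNReal.ofReal_mul zero_le_two]
  simp

/-! ### The coefficients of the noise -/

lemma integral_sum_mul_harm (a : ℕ → ℤ → ℝ) (k : HarmIndex) {n : ℕ} (hn : k.1.1 < n) :
    ∫ x, (∑ ℓ ∈ Finset.range n, ∑ m ∈ Finset.Icc (-(ℓ : ℤ)) ℓ, a ℓ m * harm ℓ m x) *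
      harm k.1.1 k.1.2 x ∂sphereMeasure = a k.1.1 k.1.2 := by
  have hint (ℓ : ℕ) (m : ℤ) : Integrable (fun x => a ℓ m * (harm ℓ m x * harm k.1.1 k.1.2 x))
      sphereMeasure :=
    ((memLp_harm ℓ m 2).integrable_mul (memLp_harm k.1.1 k.1.2 2)).const_mul _
  have hterm : ∀ ℓ : ℕ, ∀ m ∈ Finset.Icc (-(ℓ : ℤ)) ℓ,
      ∫ x, a ℓ m * (harm ℓ m x * harm k.1.1 k.1.2 x) ∂sphereMeasure =
        if (ℓ, m) = k.1 then a ℓ m else 0 := by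
    intro ℓ m hm
    rw [Finset.mem_Icc] at hm
    rw [integral_const_mul, integral_harm_mul_harm ⟨(ℓ, m), abs_le.2 hm⟩ k]
    simp [Subtype.ext_iff]
  simp only [Finset.sum_mul, mul_assoc]
  rw [integral_finsetSum _ fun ℓ _ => integrable_finsetSum _ fun m _ => hint ℓ m]
  simp only [integral_finsetSum _ fun m _ => hint _ m]
  rw [Finset.sum_congr rfl fun ℓ _ => Finset.sum_congr rfl (hterm ℓ)]
  have hk := k.2
  rw [abs_le] at hk
  rw [Finset.sum_eq_single k.1.1, Finset.sum_eq_single k.1.2]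
  · simp
  · intro m _ hm
    rw [if_neg fun h => hm (congrArg Prod.snd h)]
  · intro h
    exact absurd (Finset.mem_Icc.2 hk) h
  · intro ℓ _ hℓ
    exact Finset.sum_eq_zero fun m _ => if_neg fun h => hℓ (congrArg Prod.fst h)
  · intro h
    exact absurd (Finset.mem_range.2 hn) h

/-- The coefficients of an `L²` function expanded in spherical harmonics. -/
lemma integral_mul_harm_of_tendsto (g : L2S2) (a : ℕ → ℤ → ℝ)
    (h : Tendsto (fun κ : ℕ => eLpNorm (fun x => g x -
      ∑ ℓ ∈ Finset.range (κ + 1), ∑ m ∈ Finset.Icc (-(ℓ : ℤ)) ℓ, a ℓ m * harm ℓ m x) 2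
        sphereMeasure) atTop (𝓝 0)) (k : HarmIndex) :
    ∫ x, g x * harm k.1.1 k.1.2 x ∂sphereMeasure = a k.1.1 k.1.2 := by
  have hS (κ : ℕ) : MemLp (fun x => ∑ ℓ ∈ Finset.range (κ + 1),
      ∑ m ∈ Finset.Icc (-(ℓ : ℤ)) ℓ, a ℓ m * harm ℓ m x) 2 sphereMeasure :=
    memLp_finsetSum _ fun ℓ _ => memLp_finsetSum _ fun m _ => (memLp_harm ℓ m 2).const_mul _
  have hd (κ : ℕ) := (Lp.memLp g).sub (hS κ)
  have hnorm : Tendsto (fun κ => ‖(hd κ).toLp _‖) atTop (𝓝 0) := by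
    simp only [Lp.norm_toLp]
    rw [← ENNReal.toReal_zero]
    exact (ENNReal.tendsto_toReal ENNReal.zero_ne_top).comp h
  have hinner : Tendsto (fun κ => inner ℝ (harmLp k) ((hd κ).toLp _)) atTop (𝓝 0) := by
    refine squeeze_zero_norm (fun κ => ?_) hnorm
    refine (norm_inner_le_norm _ _).trans ?_
    rw [orthonormal_harmLp.1 k, one_mul]
  -- Once the partial sum contains the degree of k, the inner product of the remainder with this
  -- harmonic no longer depends on κ; as it tends to 0, it is 0.
  have hconst : ∀ᶠ κ in atTop, inner ℝ (harmLp k) ((hd κ).toLp _) =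
      ∫ x, g x * harm k.1.1 k.1.2 x ∂sphereMeasure - a k.1.1 k.1.2 := by
    filter_upwards [eventually_ge_atTop k.1.1] with κ hκ
    have hsub := integral_sub ((Lp.memLp g).integrable_mul (memLp_harm k.1.1 k.1.2 2))
      ((hS κ).integrable_mul (memLp_harm k.1.1 k.1.2 2))
    simp only [Pi.mul_apply] at hsub
    rw [inner_harmLp, ← integral_sum_mul_harm a k (Nat.lt_succ_of_le hκ)]
    refine Eq.trans (integral_congr_ae ?_) hsub
    filter_upwards [(hd κ).coeFn_toLp] with x hx
    rw [hx, Pi.sub_apply, sub_mul]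
  have h0 := tendsto_nhds_unique (tendsto_const_nhds.congr' (hconst.mono fun _ h => h.symm)) hinner
  linarith

/-! ### The coefficients of the solution -/

section Solution

variable {Ω : Type*} [MeasurableSpace Ω] {P : Measure Ω} {T : ℝ}

/-- Processes with continuous paths that are modifications of each other are
indistinguishable. -/
lemma ae_forall_eq_of_continuousOn {F G : ℝ → Ω → ℝ}
    (hF : ∀ᵐ ω ∂P, ContinuousOn (fun t => F t ω) (Set.Icc 0 T))
    (hG : ∀ᵐ ω ∂P, ContinuousOn (fun t => G t ω) (Set.Icc 0 T))
    (h : ∀ t ∈ Set.Icc 0 T, ∀ᵐ ω ∂P, F t ω = G t ω) :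
    ∀ᵐ ω ∂P, ∀ t ∈ Set.Icc 0 T, F t ω = G t ω := by
  obtain ⟨D, hDc, hDd⟩ := TopologicalSpace.exists_countable_dense (Set.Icc (0 : ℝ) T)
  have hD : ∀ᵐ ω ∂P, ∀ t ∈ D, F t ω = G t ω := (ae_ball_iff hDc).2 fun t _ => h t t.2
  filter_upwards [hF, hG, hD] with ω h1 h2 h3 t ht
  have := Continuous.ext_on hDd (continuousOn_iff_continuous_domRestrict.1 h1)
    (continuousOn_iff_continuous_domRestrict.1 h2) h3
  exact congrFun this ⟨t, ht⟩

/-- The frequency of the oscillators of degree `ℓ`. -/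
def freq (ℓ : ℕ) : ℝ := √((ℓ : ℝ) * (ℓ + 1))

lemma freq_sq (ℓ : ℕ) : freq ℓ ^ 2 = (ℓ : ℝ) * (ℓ + 1) :=
  Real.sq_sqrt (by positivity)

lemma continuousOn_primitive {f : ℝ → ℝ} (hf : ContinuousOn f (Set.Icc 0 T)) :
    ContinuousOn (fun t => ∫ r in (0 : ℝ)..t, f r) (Set.Icc 0 T) := by
  rcases le_or_gt 0 T with hT | hT
  · rw [← Set.uIcc_of_le hT]
    refine intervalIntegral.continuousOn_primitive_interval ?_
    rw [Set.uIcc_of_le hT]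
    exact hf.integrableOn_Icc
  · simp [Set.Icc_eq_empty hT.not_ge]

variable {A : ℕ → ℝ} {W : ℝ → Ω → L2S2} {v₁ v₂ : GenFun} {u₁ u₂ : ℝ → Ω → GenFun}

/-- The eigenfunction property supplies a multiple of the test function itself as its Laplacian,
which closes the equation on one mode. -/
lemma IsWaveSolution.velocity_harm (h : IsWaveSolution P T W v₁ v₂ u₁ u₂) (k : HarmIndex)
    {t : ℝ} (ht : t ∈ Set.Icc 0 T) : ∀ᵐ ω ∂P, u₂ t ω (harmTest k) =
      v₂ (harmTest k) - freq k.1.1 ^ 2 * (∫ r in (0 : ℝ)..t, u₁ r ω (harmTest k)) +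
        ∫ x, W t ω x * harm k.1.1 k.1.2 x ∂sphereMeasure := by
  have hq : IsSphericalLaplacian (harmTest k).1
      ((-((k.1.1 : ℝ) * (k.1.1 + 1))) • harmTest k : SphPoly).1 :=
    isSphericalLaplacian_harm k.1.1 k.1.2
  filter_upwards [h.velocity _ _ hq t ht] with ω hω
  rw [hω]
  simp only [map_smul, smul_eq_mul, intervalIntegral.integral_const_mul, freq_sq]
  rw [neg_mul, sub_eq_add_neg]
  rfl

/-- The coefficients of the solution of the stochastic wave equation. -/
lemma IsWaveSolution.ae_eq_wienerIntegral (h : IsWaveSolution P T W v₁ v₂ u₁ u₂)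
    (k : HarmIndex) {B : ℝ → Ω → ℝ} (hB : IsBrownianOn P T B) {c : ℝ}
    (hW : ∀ t ∈ Set.Icc 0 T, ∀ᵐ ω ∂P,
      ∫ x, W t ω x * harm k.1.1 k.1.2 x ∂sphereMeasure = c * B t ω)
    {t : ℝ} (ht : t ∈ Set.Icc 0 T) : ∀ᵐ ω ∂P,
      u₁ t ω (harmTest k) = Real.cos (freq k.1.1 * t) * v₁ (harmTest k) +
        oscSin (freq k.1.1) t * v₂ (harmTest k) +
        c * wienerIntegral (fun r => oscSin (freq k.1.1) (t - r))
          (fun r => -Real.cos (freq k.1.1 * (t - r))) t B ω ∧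
      u₂ t ω (harmTest k) = -(freq k.1.1 * Real.sin (freq k.1.1 * t)) * v₁ (harmTest k) +
        Real.cos (freq k.1.1 * t) * v₂ (harmTest k) +
        c * wienerIntegral (fun r => Real.cos (freq k.1.1 * (t - r)))
          (fun r => freq k.1.1 * Real.sin (freq k.1.1 * (t - r))) t B ω := by
  -- The equations hold almost surely for each fixed time, while variation of constants is pathwise;
  -- continuity gives one null set for all times.
  have hpos : ∀ᵐ ω ∂P, ∀ t ∈ Set.Icc 0 T, u₁ t ω (harmTest k) =
      v₁ (harmTest k) + ∫ r in (0 : ℝ)..t, u₂ r ω (harmTest k) := by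
    refine ae_forall_eq_of_continuousOn (h.continuous_fst _) ?_ (h.position _)
    filter_upwards [h.continuous_snd (harmTest k)] with ω hω
    exact continuousOn_const.add (continuousOn_primitive hω)
  have hvel : ∀ᵐ ω ∂P, ∀ t ∈ Set.Icc 0 T, u₂ t ω (harmTest k) =
      v₂ (harmTest k) - freq k.1.1 ^ 2 * (∫ r in (0 : ℝ)..t, u₁ r ω (harmTest k)) +
        c * B t ω := by
    refine ae_forall_eq_of_continuousOn (h.continuous_snd _) ?_ fun t ht => ?_
    · filter_upwards [h.continuous_fst (harmTest k), hB.continuous_paths] with ω h1 h2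
      exact (continuousOn_const.sub (continuousOn_const.mul (continuousOn_primitive h1))).add
        (continuousOn_const.mul h2)
    · filter_upwards [h.velocity_harm k ht, hW t ht] with ω h1 h2
      rw [h1, h2]
  filter_upwards [hpos, hvel, h.continuous_fst (harmTest k), h.continuous_snd (harmTest k),
    hB.continuous_paths] with ω h1 h2 h3 h4 h5
  have h6 : ContinuousOn (fun t => c * B t ω) (Set.Icc 0 T) := continuousOn_const.mul h5
  obtain ⟨e1, e2⟩ := oscillator_of_continuousOn h3 h4 h6 h1 h2 ht
  rw [e1, e2]
  have hcomm (F : ℝ → ℝ) : ∫ r in (0 : ℝ)..t, F r * (c * B r ω) =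
      c * ∫ r in (0 : ℝ)..t, F r * B r ω := by
    rw [← intervalIntegral.integral_const_mul]
    congr 1
    ext r
    ring
  -- Both Wiener integrals are unfolded. The kernel at r = t is 0 for the position, so no boundary
  -- term survives there, and 1 for the velocity, which leaves the noise at time t.
  constructor
  · rw [hcomm fun r => Real.cos (freq k.1.1 * (t - r))]
    simp [wienerIntegral, oscSin_zero]
  · rw [hcomm fun r => freq k.1.1 * Real.sin (freq k.1.1 * (t - r))]
    simp [wienerIntegral]
    ring

/-! ### Regularity of the solution -/

lemma eig_eq (ℓ : ℕ) : eig ℓ = 1 + freq ℓ ^ 2 := by rw [freq_sq, eig]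

lemma freq_nonneg (ℓ : ℕ) : 0 ≤ freq ℓ := Real.sqrt_nonneg _

lemma freq_le_rpow (ℓ : ℕ) : freq ℓ ≤ eig ℓ ^ (1 / 2 : ℝ) := by
  rw [← Real.sqrt_eq_rpow, eig_eq]
  exact Real.le_sqrt_of_sq_le (by linarith)

/-- The gain of one derivative. For ℓ ≥ 1 the root of `eig ℓ` is at most twice the frequency, giving
2; for ℓ = 0 the kernel is r itself, giving T. -/
lemma rpow_mul_abs_oscSin_le (ℓ : ℕ) {r : ℝ} (hr : r ∈ Set.Icc 0 T) :
    eig ℓ ^ (1 / 2 : ℝ) * |oscSin (freq ℓ) r| ≤ 2 + T := by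
  rw [← Real.sqrt_eq_rpow]
  rcases Nat.eq_zero_or_pos ℓ with rfl | hℓ
  · have : freq 0 = 0 := by simp [freq]
    simp only [eig_eq, this, oscSin, if_true]
    rw [abs_of_nonneg hr.1]
    norm_num
    linarith [hr.2]
  · have hf : 1 ≤ freq ℓ := by
      have : (1 : ℝ) ≤ ℓ := by exact_mod_cast hℓ
      exact Real.one_le_sqrt.2 (by nlinarith)
    have h2 : √(eig ℓ) ≤ 2 * freq ℓ := by
      rw [eig_eq]
      exact Real.sqrt_le_iff.2 ⟨by linarith, by nlinarith⟩
    calc √(eig ℓ) * |oscSin (freq ℓ) r| ≤ 2 * freq ℓ * |oscSin (freq ℓ) r| := by gcongr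
      _ = 2 * |Real.sin (freq ℓ * r)| := by
          rw [← mul_oscSin, abs_mul, abs_of_nonneg (freq_nonneg ℓ)]; ring
      _ ≤ 2 * 1 := by gcongr; exact Real.abs_sin_le_one _
      _ ≤ 2 + T := by linarith [hr.1.trans hr.2]

/-- Bounds for the moments of the coefficients of the stochastic convolutions, up to a factor
that only depends on `T`. -/
def noiseBound (A : ℕ → ℝ) (σ T : ℝ) (p : ℝ≥0∞) (k : HarmIndex) : ℝ≥0∞ :=
  ENNReal.ofReal (eig k.1.1 ^ ((σ - 1) / 2) * √(A k.1.1) * √T) * gaussianMoment p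

lemma tsum_noiseBound_sq_ne_top (hA : ∀ ℓ, 0 ≤ A ℓ) {ℓ₀ : ℕ} {α C σ : ℝ}
    (hdecay : ∀ ℓ : ℕ, ℓ₀ < ℓ → A ℓ ≤ C * (ℓ : ℝ) ^ (-α)) (hσ : σ < α / 2) (hT : 0 ≤ T)
    {p : ℝ≥0∞} (hp : p ≠ ∞) : ∑' k, noiseBound A σ T p k ^ 2 ≠ ∞ := by
  have h (k : HarmIndex) : noiseBound A σ T p k ^ 2 =
      (ENNReal.ofReal T * gaussianMoment p ^ 2) *
        ENNReal.ofReal (eig k.1.1 ^ (σ - 1) * A k.1.1) := by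
    have hpos := Real.rpow_nonneg (eig_pos k.1.1).le ((σ - 1) / 2)
    have e : (eig k.1.1 ^ ((σ - 1) / 2) * √(A k.1.1) * √T) ^ 2 =
        T * (eig k.1.1 ^ (σ - 1) * A k.1.1) := by
      rw [mul_pow, mul_pow, Real.sq_sqrt hT, Real.sq_sqrt (hA _), ← Real.rpow_natCast,
        ← Real.rpow_mul (eig_pos _).le]
      norm_num
      ring
    rw [noiseBound, mul_pow, ← ENNReal.ofReal_pow (by positivity), e, ENNReal.ofReal_mul hT]
    ring
  simp only [h]
  rw [ENNReal.tsum_mul_left]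
  exact ENNReal.mul_ne_top (ENNReal.mul_ne_top (by simp)
    (ENNReal.pow_ne_top (gaussianMoment_ne_top hp)))
    (tsum_harmIndex_spectrum_ne_top hA hdecay hσ)

lemma IsIsotropicWiener.exists_brownian (hW : IsIsotropicWiener P T A W) :
    ∃ β : HarmIndex → ℝ → Ω → ℝ, ∀ k, IsBrownianOn P T (β k) ∧
      ∀ t ∈ Set.Icc 0 T, ∀ᵐ ω ∂P,
        ∫ x, W t ω x * harm k.1.1 k.1.2 x ∂sphereMeasure = √(A k.1.1) * β k t ω := by
  obtain ⟨β, hβ, -, hexp⟩ := hW.expansion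
  refine ⟨fun k => β k.1.1 k.1.2, fun k => ⟨hβ k, fun t ht => ?_⟩⟩
  filter_upwards [hexp t ht] with ω hω
  exact integral_mul_harm_of_tendsto _ (fun ℓ m => √(A ℓ) * β ℓ m t ω) hω k

lemma rpow_half_eq (ℓ : ℕ) (σ : ℝ) :
    eig ℓ ^ (σ / 2) = eig ℓ ^ ((σ - 1) / 2) * eig ℓ ^ (1 / 2 : ℝ) := by
  rw [← Real.rpow_add (eig_pos ℓ)]
  congr 1
  ring

/-- Regularity of the first component of the solution of the stochastic wave equation. -/
lemma IsWaveSolution.memLpSobolev_fst [IsProbabilityMeasure P]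
    (h : IsWaveSolution P T W v₁ v₂ u₁ u₂) (hW : IsIsotropicWiener P T A W) {σ : ℝ}
    {m : ℕ} (hm : 1 ≤ m) (hfin : ∑' k, noiseBound A σ T (2 * m) k ^ 2 ≠ ∞)
    (hv₁ : MemSobolev σ v₁) (hv₂ : MemSobolev (σ - 1) v₂) {t : ℝ} (ht : t ∈ Set.Icc 0 T) :
    MemLpSobolev P (2 * m) σ (u₁ t) ∧ lpSobolevNorm P (2 * m) σ (u₁ t) ≤
      4 * ENNReal.ofReal (2 + T) * (1 + ∑' k, noiseBound A σ T (2 * m) k ^ 2) *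
        (1 + sobolevNorm σ v₁ + sobolevNorm (σ - 1) v₂) := by
  obtain ⟨β, hβ⟩ := hW.exists_brownian
  have hT : 0 ≤ T := ht.1.trans ht.2
  have hder (k : HarmIndex) := hasDerivAt_oscSin_sub (freq k.1.1) t
  have hcont (k : HarmIndex) : Continuous fun r => -Real.cos (freq k.1.1 * (t - r)) := by
    fun_prop
  refine memLpSobolev_of_coeff hm hv₁ hv₂
    -- The weight of order σ matches that of v₁; against v₂, of order σ - 1, a factor `eig ^ (1/2)`
    -- is left over and is absorbed by the sine kernel.
    (a := fun k => Real.cos (freq k.1.1 * t))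
    (b := fun k => eig k.1.1 ^ (1 / 2 : ℝ) * oscSin (freq k.1.1) t)
    (X := fun k => (eig k.1.1 ^ (σ / 2) * √(A k.1.1)) •
      wienerIntegral (fun r => oscSin (freq k.1.1) (t - r))
        (fun r => -Real.cos (freq k.1.1 * (t - r))) t (β k))
    (fun k => (Real.abs_cos_le_one _).trans (by linarith)) (fun k => ?_) (fun k => ?_)
    (fun k => ?_) hfin fun k => ?_
  · rw [abs_mul, abs_of_nonneg (Real.rpow_nonneg (eig_pos _).le _)]
    exact rpow_mul_abs_oscSin_le k.1.1 ht
  · exact ((hβ k).1.aestronglyMeasurable_wienerIntegral (hder k) (hcont k) ht).const_smul _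
  · have hpos := Real.rpow_pos_of_pos (eig_pos k.1.1) (1 / 2 : ℝ)
    have hpos2 := Real.rpow_nonneg (eig_pos k.1.1).le (σ / 2)
    have hw := (hβ k).1.eLpNorm_wienerIntegral_le (hder k) (hcont k)
      -- The decay of the kernel lowers the weight from σ/2 to (σ - 1)/2, as in `noiseBound`.
      (K := (2 + T) / eig k.1.1 ^ (1 / 2 : ℝ)) ht (fun r hr => by
        rw [le_div_iff₀' hpos]
        exact rpow_mul_abs_oscSin_le k.1.1
          ⟨sub_nonneg.2 hr.2, (sub_le_self t hr.1).trans ht.2⟩) (2 * m)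
    rw [eLpNorm_const_smul, Real.enorm_eq_ofReal (by positivity)]
    refine (mul_le_mul_right hw _).trans (le_of_eq ?_)
    rw [noiseBound, ← mul_assoc, ← mul_assoc, ← ENNReal.ofReal_mul (by positivity),
      ← ENNReal.ofReal_mul (by positivity), rpow_half_eq k.1.1 σ]
    congr 2
    field_simp
  · filter_upwards [h.ae_eq_wienerIntegral k (hβ k).1 (hβ k).2 ht] with ω hω
    simp only [besselCoeff, hω.1, Pi.smul_apply, smul_eq_mul]
    rw [rpow_half_eq k.1.1 σ]
    ring

/-- Regularity of the second component of the solution of the stochastic wave equation. -/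
lemma IsWaveSolution.memLpSobolev_snd [IsProbabilityMeasure P]
    (h : IsWaveSolution P T W v₁ v₂ u₁ u₂) (hW : IsIsotropicWiener P T A W) {σ : ℝ}
    {m : ℕ} (hm : 1 ≤ m) (hfin : ∑' k, noiseBound A σ T (2 * m) k ^ 2 ≠ ∞)
    (hv₁ : MemSobolev σ v₁) (hv₂ : MemSobolev (σ - 1) v₂) {t : ℝ} (ht : t ∈ Set.Icc 0 T) :
    MemLpSobolev P (2 * m) (σ - 1) (u₂ t) ∧ lpSobolevNorm P (2 * m) (σ - 1) (u₂ t) ≤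
      4 * ENNReal.ofReal (2 + T) * (1 + ∑' k, noiseBound A σ T (2 * m) k ^ 2) *
        (1 + sobolevNorm σ v₁ + sobolevNorm (σ - 1) v₂) := by
  obtain ⟨β, hβ⟩ := hW.exists_brownian
  have hT : 0 ≤ T := ht.1.trans ht.2
  have hder (k : HarmIndex) := hasDerivAt_cos_mul_sub (freq k.1.1) t
  have hcont (k : HarmIndex) :
      Continuous fun r => freq k.1.1 * Real.sin (freq k.1.1 * (t - r)) := by
    fun_prop
  refine memLpSobolev_of_coeff hm hv₁ hv₂
    -- In order σ - 1 the data v₁ has weight to spare, which compensates the factor ω from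
    -- differentiating the cosine; v₂ and the noise need no compensation.
    (a := fun k => -(freq k.1.1 / eig k.1.1 ^ (1 / 2 : ℝ) * Real.sin (freq k.1.1 * t)))
    (b := fun k => Real.cos (freq k.1.1 * t))
    (X := fun k => (eig k.1.1 ^ ((σ - 1) / 2) * √(A k.1.1)) •
      wienerIntegral (fun r => Real.cos (freq k.1.1 * (t - r)))
        (fun r => freq k.1.1 * Real.sin (freq k.1.1 * (t - r))) t (β k))
    (fun k => ?_) (fun k => (Real.abs_cos_le_one _).trans (by linarith)) (fun k => ?_)
    (fun k => ?_) hfin fun k => ?_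
  · have hpos := Real.rpow_pos_of_pos (eig_pos k.1.1) (1 / 2 : ℝ)
    rw [abs_neg, abs_mul, abs_of_nonneg (div_nonneg (freq_nonneg _) hpos.le)]
    refine (mul_le_one₀ ?_ (abs_nonneg _) (Real.abs_sin_le_one _)).trans (by linarith)
    exact (div_le_one hpos).2 (freq_le_rpow _)
  · exact ((hβ k).1.aestronglyMeasurable_wienerIntegral (hder k) (hcont k) ht).const_smul _
  · have hpos2 := Real.rpow_nonneg (eig_pos k.1.1).le ((σ - 1) / 2)
    have hw := (hβ k).1.eLpNorm_wienerIntegral_le (hder k) (hcont k) (K := 2 + T) ht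
      (fun r _ => (Real.abs_cos_le_one _).trans (by linarith)) (2 * m)
    rw [eLpNorm_const_smul, Real.enorm_eq_ofReal (by positivity)]
    refine (mul_le_mul_right hw _).trans (le_of_eq ?_)
    rw [noiseBound, ← mul_assoc, ← mul_assoc, ← ENNReal.ofReal_mul (by positivity),
      ← ENNReal.ofReal_mul (by positivity)]
    congr 2
    ring
  · have hpos := Real.rpow_pos_of_pos (eig_pos k.1.1) (1 / 2 : ℝ)
    filter_upwards [h.ae_eq_wienerIntegral k (hβ k).1 (hβ k).2 ht] with ω hω
    simp only [besselCoeff, hω.2, Pi.smul_apply, smul_eq_mul]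
    rw [rpow_half_eq k.1.1 σ]
    field_simp

end Solution

end SphereWave

end

theorem proposition3p3 (A : ℕ → ℝ) (hA : ∀ ℓ, 0 ≤ A ℓ) (ℓ₀ : ℕ) (α C : ℝ) (hα : 2 < α)
    (hC : 0 < C) (hdecay : ∀ ℓ : ℕ, ℓ₀ < ℓ → A ℓ ≤ C * (ℓ : ℝ) ^ (-α))
    (T : ℝ) (hT : 0 ≤ T) (m : ℕ) (hm : 1 ≤ m) :
    (∀ s : ℝ, s < α / 2 → ∃ M : ℝ≥0,
      ∀ (Ω : Type*) [MeasurableSpace Ω] (P : Measure Ω) [IsProbabilityMeasure P]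
        (W : ℝ → Ω → L2S2) (v₁ v₂ : GenFun) (u₁ u₂ : ℝ → Ω → GenFun),
        IsIsotropicWiener P T A W → IsWaveSolution P T W v₁ v₂ u₁ u₂ →
        MemSobolev s v₁ → MemSobolev (s - 1) v₂ → ∀ t ∈ Set.Icc 0 T,
          MemLpSobolev P (2 * m) s (u₁ t) ∧
          lpSobolevNorm P (2 * m) s (u₁ t) ≤
            M * (1 + sobolevNorm s v₁ + sobolevNorm (s - 1) v₂) ∧
          M * (1 + sobolevNorm s v₁ + sobolevNorm (s - 1) v₂) < ∞) ∧
    (∀ s : ℝ, s < α / 2 - 1 → ∃ M : ℝ≥0,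
      ∀ (Ω : Type*) [MeasurableSpace Ω] (P : Measure Ω) [IsProbabilityMeasure P]
        (W : ℝ → Ω → L2S2) (v₁ v₂ : GenFun) (u₁ u₂ : ℝ → Ω → GenFun),
        IsIsotropicWiener P T A W → IsWaveSolution P T W v₁ v₂ u₁ u₂ →
        MemSobolev (s + 1) v₁ → MemSobolev s v₂ → ∀ t ∈ Set.Icc 0 T,
          MemLpSobolev P (2 * m) s (u₂ t) ∧
          lpSobolevNorm P (2 * m) s (u₂ t) ≤
            M * (1 + sobolevNorm (s + 1) v₁ + sobolevNorm s v₂) ∧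
          M * (1 + sobolevNorm (s + 1) v₁ + sobolevNorm s v₂) < ∞) := by

  have hp : (2 * m : ℝ≥0∞) ≠ ∞ := by finiteness
  -- The constant is built from σ, m, T and A only, so it is fixed before the probability space, the
  -- noise, the data and the solution.
  set R : ℝ → ℝ≥0∞ := fun σ =>
    4 * ENNReal.ofReal (2 + T) * (1 + ∑' k, noiseBound A σ T (2 * m) k ^ 2) with hR
  have hfin (σ : ℝ) (hσ : σ < α / 2) : R σ ≠ ∞ :=
    ENNReal.mul_ne_top (by finiteness)
      (by simpa using tsum_noiseBound_sq_ne_top hA hdecay hσ hT hp)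
  have hlt (σ : ℝ) (v₁ v₂ : GenFun) (hv₁ : MemSobolev σ v₁) (hv₂ : MemSobolev (σ - 1) v₂) :
      ((R σ).toNNReal : ℝ≥0∞) * (1 + sobolevNorm σ v₁ + sobolevNorm (σ - 1) v₂) < ∞ :=
    ENNReal.mul_lt_top ENNReal.coe_lt_top (ENNReal.add_lt_top.2
      ⟨ENNReal.add_lt_top.2 ⟨ENNReal.one_lt_top, hv₁.sobolevNorm_ne_top.lt_top⟩,
        hv₂.sobolevNorm_ne_top.lt_top⟩)
  constructor
  · intro s hs
    refine ⟨(R s).toNNReal, fun Ω _ P _ W v₁ v₂ u₁ u₂ hW hu hv₁ hv₂ t ht => ?_⟩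
    obtain ⟨h1, h2⟩ := hu.memLpSobolev_fst hW hm
      (tsum_noiseBound_sq_ne_top hA hdecay hs hT hp) hv₁ hv₂ ht
    refine ⟨h1, ?_, hlt s v₁ v₂ hv₁ hv₂⟩
    rwa [ENNReal.coe_toNNReal (hfin s hs)]
  · intro s hs
    -- The velocity is treated with σ = s + 1, so that its order σ - 1 is s.
    have hs' : s + 1 < α / 2 := by linarith
    refine ⟨(R (s + 1)).toNNReal, fun Ω _ P _ W v₁ v₂ u₁ u₂ hW hu hv₁ hv₂ t ht => ?_⟩
    have e : s + 1 - 1 = s := add_sub_cancel_right s 1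
    obtain ⟨h1, h2⟩ := hu.memLpSobolev_snd hW hm
      (tsum_noiseBound_sq_ne_top hA hdecay hs' hT hp) hv₁ (by rwa [e]) ht
    have h3 := hlt (s + 1) v₁ v₂ hv₁ (by rwa [e])
    rw [e] at h1 h2 h3
    refine ⟨h1, ?_, h3⟩
    rwa [ENNReal.coe_toNNReal (hfin _ hs')]
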